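/- There is an absolute constant $C>0$ with the following property. Let $a$ be a symmetric real random variable with unit variance that is sub-gaussian, i.e. $\kappa := \sup_{p\ge 1} p^{-1/2}(\mathbb E|a|^p)^{1/p}<\infty$, and whose law is within $\varepsilon$ of the standard normal law in total variation: $\sup_{B}|\mathbb P(a\in B)-\mathbb P(g\in B)|\le\varepsilon$, where $g\sim N(0,1)$ and $B$ ranges over the Borel subsets of $\mathbb R$. Let $m\ge 1$ and let $a_1,\dots,a_m$ be independent random vectors in $\mathbb R^n$ whose coordinates are i.i.d. copies of $a$. Let $K\subseteq B_2^n$ be a subset of the closed Euclidean unit ball, and fix $x\in K$ with $\|x\|_2=1$. Let $\theta:\mathbb R\to[-1,1]$ be a $C^2$ function with $|\theta'|\le\tau_1$ and $|\theta''|\le\tau_2$ on $\mathbb R$, and such that $\lambda:=\mathbb E\,\theta(g)g>0$. Let $y_1,\dots,y_m$ be random variables with values in $\{-1,1\}$ that, conditionally on $(a_1,\dots,a_m)$, are independent with means $\mathbb E(y_i\mid a_1,\dots,a_m)=\theta(\langle a_i,x\rangle)$. Let $$w(K)=\mathbb E\sup_{z\in K-K}\langle g_n,z\rangle,$$ with $g_n$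 a standard Gaussian vector in $\mathbb R^n$, be the Gaussian mean width of $K$. Then for each $\beta>0$, with probability at least $1-4e^{-\beta^2}$, every solution $\widehat x$ of the optimization problem $$\max\ \sum_{i=1}^m y_i\langle a_i,x'\rangle\quad\text{subject to}\quad x'\in K$$ satisfies $$\|x-\widehat x\|_2^2\le C\left(\frac{(\kappa^3+1)(\tau_1+\tau_2)\sqrt{\varepsilon}}{\lambda}+\frac{\kappa\,(w(K)+\beta)}{\lambda\sqrt m}\right).$$ -/

import Mathlib

open MeasureTheory ProbabilityTheory
open scoped ENNReal Pointwise RealInnerProductSpace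

noncomputable section

/-- The sub-gaussian norm `κ = sup_{p ≥ 1} p^{-1/2} (𝔼 |X|^p)^{1/p}`, as an extended
nonnegative number; `X` is sub-gaussian when it is finite. -/
def subgaussianNorm {Ω : Type*} [MeasurableSpace Ω] (X : Ω → ℝ) (P : Measure Ω) : ℝ≥0∞ :=
  ⨆ (p : ℝ) (_ : 1 ≤ p), ENNReal.ofReal (p ^ (-(1 / 2) : ℝ)) * eLpNorm X (ENNReal.ofReal p) P

/-- The total variation distance `sup_A |μ(A) - ν(A)|`, over measurable `A`, of two
(probability) measures. -/
def tvDist {α : Type*} [MeasurableSpace α] (μ ν : Measure α) : ℝ :=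
  ⨆ A : {A : Set α // MeasurableSet A}, |μ.real A - ν.real A|

/-- The Gaussian mean width `w(K) = 𝔼 sup_{z ∈ K - K} ⟨g, z⟩`, with `g` a standard Gaussian
vector in `ℝⁿ`. -/
def gaussianMeanWidth {n : ℕ} (K : Set (EuclideanSpace ℝ (Fin n))) : ℝ :=
  ∫ g, sSup ((fun z => ⟪g, z⟫) '' (K - K)) ∂(stdGaussian (EuclideanSpace ℝ (Fin n)))

/-- Conditional independence of a finite family of real random variables given the
`σ`-algebra `𝓖`: the conditional probability of every measurable box factorizes. -/
def CondIndepGiven {Ω : Type*} {m : ℕ} (𝓖 : MeasurableSpace Ω) [MeasurableSpace Ω]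
    (y : Fin m → Ω → ℝ) (μ : Measure Ω) : Prop :=
  ∀ B : Fin m → Set ℝ, (∀ i, MeasurableSet (B i)) →
    μ⟦⋂ i, y i ⁻¹' B i | 𝓖⟧ =ᵐ[μ] fun ω => ∏ i, (μ⟦y i ⁻¹' B i | 𝓖⟧) ω

/-- The generalized linear model: the `y i` take values in `{-1, 1}` and, conditionally on
all the measurement vectors `A`, they are independent with means `θ (⟨A i, x⟩)`. -/
structure GeneralizedLinearModel {Ω : Type*} [MeasurableSpace Ω] {m n : ℕ} (μ : Measure Ω)
    (θ : ℝ → ℝ) (x : EuclideanSpace ℝ (Fin n)) (A : Fin m → Ω → EuclideanSpace ℝ (Fin n))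
    (y : Fin m → Ω → ℝ) : Prop where
  measurable : ∀ i, Measurable (y i)
  sign_valued : ∀ i ω, y i ω = -1 ∨ y i ω = 1
  condMean : ∀ i, μ[y i | MeasurableSpace.comap (fun ω k => A k ω) inferInstance]
    =ᵐ[μ] fun ω => θ ⟪A i ω, x⟫
  condIndep : CondIndepGiven (MeasurableSpace.comap (fun ω k => A k ω) inferInstance) y μ

/-- `z` solves: maximize `∑ i, y i * ⟨a i, x'⟩` subject to `x' ∈ K`. -/
def IsSolution {m n : ℕ} (K : Set (EuclideanSpace ℝ (Fin n)))
    (a : Fin m → EuclideanSpace ℝ (Fin n)) (y : Fin m → ℝ)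
    (z : EuclideanSpace ℝ (Fin n)) : Prop :=
  z ∈ K ∧ IsMaxOn (fun x' => ∑ i, y i * ⟪a i, x'⟫) K z

end

/-! ### Integrals of square-integrable functions under total variation closeness. -/

section TotalVariation

variable {α : Type*} [MeasurableSpace α]

/-! Since `xhat` maximizes `∑ y i * ⟪A i, ·⟫` over `K`, this functional is nonnegative at `xhat -
x`. Write `y i • A i` as its mean `v i` plus a fluctuation, and let `D` be the sum of the
fluctuations. If `v i` were exactly `lam • x`, the mean part would be `m * lam * ⟪x, xhat - x⟫ ≤ -m
* lam * ‖x - xhat‖ ^ 2 / 2`, because `‖xhat‖ ≤ 1 = ‖x‖`. Hence `‖x - xhat‖ ^ 2` is controlled by two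
quantities: the bias `v i - lam • x` and the supremum of `⟪D, ·⟫` over `K - K`
(`norm_sub_sq_le_of_isSolution`).

Bias. The `j`-th coordinate of `v i` is `𝔼 θ(S) a_j` with `S = ⟪A i, x⟫`. With the other coordinates
frozen, Gaussian integration by parts holds for `a_j` up to `√ε`, which gives `𝔼 θ(S) a_j ≈ x_j 𝔼
θ'(S)`. Then `𝔼 θ'(S)` is compared with `𝔼 θ'(g) = lam` by Stein's method: the solution `f` of
Stein's equation has bounded derivative, so the same approximate integration by parts applies to `f`
(`abs_integral_comp_sum_mul_sub_gaussian_le`). Every error carries a factor `|x_j|`, so the total is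
free of the dimension.

Fluctuation. A symmetric sub-gaussian variable is dominated in the convex order by a Gaussian of
standard deviation of order `κ`. This order is stable under linear maps and convolution, and
recentring after a random sign costs a factor `2`; hence `D` is dominated by a multiple of order
`κ√m` of a standard Gaussian vector (`GeneralizedLinearModel.convexDominated_sum`). The exponential
of a support function is convex, so its exponential moment is bounded by the Gaussian one. That one
is handled by rotating a Gaussian pair through a quarter turn in small steps
(`lintegral_exp_supportFunction_stdGaussian_le`), and Markov's inequality gives the tail. -/

lemma bddAbove_range_abs_real_sub (μ ν : Measure α) [IsProbabilityMeasure μ]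
    [IsProbabilityMeasure ν] :
    BddAbove (Set.range fun A : {A : Set α // MeasurableSet A} => |μ.real A - ν.real A|) := by
  refine ⟨1, ?_⟩
  rintro _ ⟨A, rfl⟩
  have h1 : μ.real (A : Set α) ≤ 1 := measureReal_le_one
  have h2 : ν.real (A : Set α) ≤ 1 := measureReal_le_one
  have h3 : 0 ≤ μ.real (A : Set α) := measureReal_nonneg
  have h4 : 0 ≤ ν.real (A : Set α) := measureReal_nonneg
  exact abs_le.2 ⟨by linarith, by linarith⟩

lemma abs_real_sub_le_tvDist (μ ν : Measure α) [IsProbabilityMeasure μ] [IsProbabilityMeasure ν]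
    {A : Set α} (hA : MeasurableSet A) : |μ.real A - ν.real A| ≤ tvDist μ ν :=
  le_ciSup (bddAbove_range_abs_real_sub μ ν) ⟨A, hA⟩

lemma abs_integral_le_sqrt_mul_sqrt {ρ : Measure α} [IsFiniteMeasure ρ] {φ : α → ℝ}
    (hφ : MemLp φ 2 ρ) : |∫ t, φ t ∂ρ| ≤ √(ρ.real Set.univ) * √(∫ t, φ t ^ 2 ∂ρ) := by
  have habs : MemLp (fun t => |φ t|) 2 ρ := hφ.abs
  have h := integral_mul_le_Lp_mul_Lq_of_nonneg (μ := ρ) Real.HolderConjugate.two_two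
    (f := fun _ => (1 : ℝ)) (g := fun t => |φ t|) (Filter.Eventually.of_forall fun _ => zero_le_one)
    (Filter.Eventually.of_forall fun _ => abs_nonneg _) (memLp_const 1)
    (by rw [ENNReal.ofReal_ofNat]; exact habs)
  simp only [one_mul, integral_const, smul_eq_mul, Real.rpow_two, sq_abs, one_pow, mul_one] at h
  rw [← Real.sqrt_eq_rpow, ← Real.sqrt_eq_rpow] at h
  exact (abs_integral_le_integral_abs).trans h

/-- Cauchy–Schwarz against the positive measure `μ - ν`, whose mass is the difference of the masses;
the second moment is then enlarged from `μ - ν` to `μ`. -/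
lemma abs_integral_sub_le_of_le {μ ν : Measure α} [IsFiniteMeasure μ] (hle : ν ≤ μ)
    {φ : α → ℝ} (hφ : MemLp φ 2 μ) :
    |∫ t, φ t ∂μ - ∫ t, φ t ∂ν| ≤
      √(μ.real Set.univ - ν.real Set.univ) * √(∫ t, φ t ^ 2 ∂μ) := by
  have : IsFiniteMeasure ν := isFiniteMeasure_of_le μ hle
  have hadd : μ - ν + ν = μ := Measure.sub_add_cancel_of_le hle
  have hsub : μ - ν ≤ μ := Measure.sub_le
  have h1 : ∫ t, φ t ∂μ = ∫ t, φ t ∂(μ - ν) + ∫ t, φ t ∂ν := by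
    conv_lhs => rw [← hadd]
    exact integral_add_measure ((hφ.mono_measure hsub).integrable one_le_two)
      ((hφ.mono_measure hle).integrable one_le_two)
  have h2 : (μ - ν).real Set.univ = μ.real Set.univ - ν.real Set.univ := by
    have : μ.real Set.univ = (μ - ν).real Set.univ + ν.real Set.univ := by
      conv_lhs => rw [← hadd]
      rw [measureReal_add_apply]
    linarith
  rw [h1, add_sub_cancel_right, ← h2]
  refine (abs_integral_le_sqrt_mul_sqrt (hφ.mono_measure hsub)).trans ?_
  gcongr
  · exact Filter.Eventually.of_forall fun t => sq_nonneg _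
  · exact hφ.integrable_sq

/-- On a Hahn set one measure dominates, on its complement the other, and on each piece the masses
differ by at most `ε`. Since `φ` may be unbounded, Cauchy–Schwarz trades this mass for `√ε` times an
`L²` norm. -/
lemma abs_integral_sub_le_of_tvDist_le {μ ν : Measure α} [IsProbabilityMeasure μ]
    [IsProbabilityMeasure ν] {ε : ℝ} (hε : tvDist μ ν ≤ ε) {φ : α → ℝ} (hμ : MemLp φ 2 μ)
    (hν : MemLp φ 2 ν) :
    |∫ t, φ t ∂μ - ∫ t, φ t ∂ν| ≤ √ε * (√(∫ t, φ t ^ 2 ∂μ) + √(∫ t, φ t ^ 2 ∂ν)) := by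
  obtain ⟨s, hs, h1, h2⟩ := hahn_decomposition μ ν
  have l1 : ν.restrict s ≤ μ.restrict s := Measure.le_iff.2 fun t ht => by
    rw [Measure.restrict_apply ht, Measure.restrict_apply ht]
    exact h1 _ (ht.inter hs) Set.inter_subset_right
  have l2 : μ.restrict sᶜ ≤ ν.restrict sᶜ := Measure.le_iff.2 fun t ht => by
    rw [Measure.restrict_apply ht, Measure.restrict_apply ht]
    exact h2 _ (ht.inter hs.compl) Set.inter_subset_right
  have k1 := abs_integral_sub_le_of_le l1 (hμ.restrict s)
  have k2 := abs_integral_sub_le_of_le l2 (hν.restrict sᶜ)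
  simp only [measureReal_restrict_apply_univ] at k1 k2
  have e1 : √(μ.real s - ν.real s) ≤ √ε :=
    Real.sqrt_le_sqrt ((le_abs_self _).trans ((abs_real_sub_le_tvDist μ ν hs).trans hε))
  have e2 : √(ν.real sᶜ - μ.real sᶜ) ≤ √ε :=
    Real.sqrt_le_sqrt ((neg_sub (μ.real sᶜ) _ ▸ neg_le_abs _).trans
      ((abs_real_sub_le_tvDist μ ν hs.compl).trans hε))
  have f1 : √(∫ t in s, φ t ^ 2 ∂μ) ≤ √(∫ t, φ t ^ 2 ∂μ) :=
    Real.sqrt_le_sqrt (setIntegral_le_integral hμ.integrable_sq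
      (Filter.Eventually.of_forall fun t => sq_nonneg _))
  have f2 : √(∫ t in sᶜ, φ t ^ 2 ∂ν) ≤ √(∫ t, φ t ^ 2 ∂ν) :=
    Real.sqrt_le_sqrt (setIntegral_le_integral hν.integrable_sq
      (Filter.Eventually.of_forall fun t => sq_nonneg _))
  rw [← integral_add_compl hs (hμ.integrable one_le_two),
    ← integral_add_compl hs (hν.integrable one_le_two)]
  have k1' := k1.trans (mul_le_mul e1 f1 (Real.sqrt_nonneg _) (Real.sqrt_nonneg _))
  have k2' := k2.trans (mul_le_mul e2 f2 (Real.sqrt_nonneg _) (Real.sqrt_nonneg _))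
  rw [abs_le] at *
  constructor <;> nlinarith

end TotalVariation

/-! ### Gaussian integration by parts for functions with bounded derivative. -/

section GaussianIntegrationByParts

lemma gaussianPDFReal_std (t : ℝ) :
    gaussianPDFReal 0 1 t = (√(2 * Real.pi))⁻¹ * Real.exp (-t ^ 2 / 2) := by
  simp [gaussianPDFReal]

lemma hasDerivAt_gaussianPDFReal_std (t : ℝ) :
    HasDerivAt (gaussianPDFReal 0 1) (-t * gaussianPDFReal 0 1 t) t := by
  have h : gaussianPDFReal 0 1 = fun t => (√(2 * Real.pi))⁻¹ * Real.exp (-t ^ 2 / 2) :=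
    funext gaussianPDFReal_std
  rw [h]
  have h1 : HasDerivAt (fun t : ℝ => -t ^ 2 / 2) (-t) t := by
    refine (((hasDerivAt_pow 2 t).neg).div_const 2).congr_deriv ?_
    norm_num
    ring
  refine (h1.exp.const_mul (√(2 * Real.pi))⁻¹).congr_deriv ?_
  ring

lemma integral_gaussianReal_std (f : ℝ → ℝ) :
    ∫ t, f t ∂(gaussianReal 0 1) = ∫ t, f t * gaussianPDFReal 0 1 t := by
  rw [integral_gaussianReal_eq_integral_smul one_ne_zero]
  simp [mul_comm]

lemma integrable_gaussianReal_std_iff (f : ℝ → ℝ) :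
    Integrable f (gaussianReal 0 1) ↔ Integrable (fun t => f t * gaussianPDFReal 0 1 t) := by
  rw [gaussianReal_of_var_ne_zero 0 one_ne_zero,
    integrable_withDensity_iff (measurable_gaussianPDF 0 1)
      (Filter.Eventually.of_forall fun _ => gaussianPDF_lt_top)]
  simp

lemma abs_le_of_abs_deriv_le {q q' : ℝ → ℝ} {M : ℝ} (hq : ∀ t, HasDerivAt q (q' t) t)
    (hM : ∀ t, |q' t| ≤ M) (s t : ℝ) : |q s - q t| ≤ M * |s - t| :=
  Convex.norm_image_sub_le_of_norm_hasDerivWithin_le (s := Set.univ)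
    (fun u _ => (hq u).hasDerivWithinAt) (fun u _ => hM u) convex_univ trivial trivial

lemma continuous_of_hasDerivAt {q q' : ℝ → ℝ} (hq : ∀ t, HasDerivAt q (q' t) t) : Continuous q :=
  continuous_iff_continuousAt.2 fun t => (hq t).continuousAt

lemma memLp_id_gaussianReal_std (p : ℝ≥0∞) (hp : p ≠ ∞) :
    MemLp (fun t : ℝ => t) p (gaussianReal 0 1) := memLp_id_gaussianReal' p hp

lemma memLp_of_abs_deriv_le {ν : Measure ℝ} [IsFiniteMeasure ν] {p : ℝ≥0∞}
    (hν : MemLp (fun t : ℝ => t) p ν) {q q' : ℝ → ℝ} {M : ℝ} (hq : ∀ t, HasDerivAt q (q' t) t)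
    (hM : ∀ t, |q' t| ≤ M) : MemLp q p ν := by
  have h1 : MemLp (fun t : ℝ => |q 0| + M * |t|) p ν :=
    (memLp_const |q 0|).add (hν.abs.const_mul M)
  refine h1.mono' (continuous_of_hasDerivAt hq).aestronglyMeasurable
    (Filter.Eventually.of_forall fun t => ?_)
  have h2 := abs_le_of_abs_deriv_le hq hM t 0
  rw [sub_zero] at h2
  have := abs_sub_abs_le_abs_sub (q t) (q 0)
  rw [Real.norm_eq_abs]
  linarith

/-- The normal density `p` satisfies `p' = -t p`, so `q t p = -q p'`; the linear growth of `q`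
provides the integrability. -/
lemma integral_mul_self_gaussianReal_eq_integral_deriv {q q' : ℝ → ℝ} {M : ℝ}
    (hq : ∀ t, HasDerivAt q (q' t) t) (hc : Continuous q') (hM : ∀ t, |q' t| ≤ M) :
    ∫ t, q t * t ∂(gaussianReal 0 1) = ∫ t, q' t ∂(gaussianReal 0 1) := by
  have hq2 : MemLp q 2 (gaussianReal 0 1) :=
    memLp_of_abs_deriv_le (memLp_id_gaussianReal_std 2 (by simp)) hq hM
  have i1 : Integrable (fun t => q t * t) (gaussianReal 0 1) :=
    hq2.integrable_mul (memLp_id_gaussianReal_std 2 (by simp))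
  have i2 : Integrable q' (gaussianReal 0 1) :=
    Integrable.of_bound hc.aestronglyMeasurable M (Filter.Eventually.of_forall hM)
  have i3 := hq2.integrable one_le_two
  rw [integrable_gaussianReal_std_iff] at i1 i2 i3
  have := integral_mul_deriv_eq_deriv_mul_of_integrable (u := q) (u' := q')
    (v := gaussianPDFReal 0 1) (v' := fun t => -t * gaussianPDFReal 0 1 t)
    (fun x _ => hq x) (fun x _ => hasDerivAt_gaussianPDFReal_std x)
    (by convert i1.neg using 1; ext t; simp; ring) i2 i3
  rw [integral_gaussianReal_std, integral_gaussianReal_std]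
  rw [← neg_inj, ← this, ← integral_neg]
  congr 1; ext t; ring

end GaussianIntegrationByParts

/-! ### Stein's equation for the normal law. -/

section SteinEquation

open Filter Topology Set

lemma integrable_id_mul_gaussianPDFReal_std :
    Integrable (fun t : ℝ => t * gaussianPDFReal 0 1 t) :=
  (integrable_gaussianReal_std_iff _).1
    ((memLp_id_gaussianReal_std 1 (by simp)).integrable le_rfl)

lemma tendsto_gaussianPDFReal_std_cocompact :
    Tendsto (gaussianPDFReal 0 1) (cocompact ℝ) (𝓝 0) := by
  have h : gaussianPDFReal 0 1 = fun t => (√(2 * Real.pi))⁻¹ * Real.exp (-t ^ 2 / 2) :=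
    funext gaussianPDFReal_std
  rw [h]
  have h1 : Tendsto (fun t : ℝ => -t ^ 2 / 2) (cocompact ℝ) atBot := by
    have h2 : Tendsto (fun t : ℝ => ‖t‖ ^ 2) (cocompact ℝ) atTop :=
      (tendsto_pow_atTop two_ne_zero).comp (tendsto_norm_cocompact_atTop (E := ℝ))
    have h3 := tendsto_neg_atTop_atBot.comp (h2.atTop_div_const (two_pos : (0 : ℝ) < 2))
    refine h3.congr fun t => ?_
    simp [neg_div]
  simpa using (Real.tendsto_exp_atBot.comp h1).const_mul (√(2 * Real.pi))⁻¹

lemma integral_Ioi_id_mul_gaussianPDFReal_std (t : ℝ) :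
    ∫ s in Ioi t, s * gaussianPDFReal 0 1 s = gaussianPDFReal 0 1 t := by
  have h := integral_Ioi_of_hasDerivAt_of_tendsto' (a := t)
    (fun s _ => hasDerivAt_gaussianPDFReal_std s)
    (by simpa [neg_mul] using integrable_id_mul_gaussianPDFReal_std.neg.integrableOn)
    (tendsto_gaussianPDFReal_std_cocompact.mono_left atTop_le_cocompact)
  simp only [neg_mul, integral_neg, zero_sub, neg_inj] at h
  exact h

lemma integral_Iic_id_mul_gaussianPDFReal_std (t : ℝ) :
    ∫ s in Iic t, s * gaussianPDFReal 0 1 s = - gaussianPDFReal 0 1 t := by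
  have h := integral_Iic_of_hasDerivAt_of_tendsto' (a := t)
    (fun s _ => hasDerivAt_gaussianPDFReal_std s)
    (by simpa [neg_mul] using integrable_id_mul_gaussianPDFReal_std.neg.integrableOn)
    (tendsto_gaussianPDFReal_std_cocompact.mono_left atBot_le_cocompact)
  simp only [neg_mul, integral_neg, sub_zero] at h
  linarith

/-- Mills-ratio bound for the primitive of a bounded centred multiple of the normal density. -/
lemma abs_mul_abs_integral_Iic_le {k : ℝ → ℝ} {B : ℝ} (hk : Continuous k)
    (hB : ∀ t, |k t| ≤ B) (h0 : ∫ t, k t * gaussianPDFReal 0 1 t = 0) (t : ℝ) :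
    |t| * |∫ s in Iic t, k s * gaussianPDFReal 0 1 s| ≤ B * gaussianPDFReal 0 1 t := by
  have hint : Integrable (fun s => k s * gaussianPDFReal 0 1 s) := by
    rw [← integrable_gaussianReal_std_iff]
    exact Integrable.of_bound hk.aestronglyMeasurable B (Eventually.of_forall hB)
  have hB0 : 0 ≤ B := (abs_nonneg _).trans (hB 0)
  rcases le_or_gt 0 t with ht | ht
  -- For `t ≥ 0` the centring turns the integral over `(-∞, t]` into minus the one over `(t, ∞)`.
  -- There `t ≤ s`, so `t` is absorbed into `s`, and `s` times the density integrates exactly to the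
  -- density at `t`.
  · have hsplit : ∫ s in Iic t, k s * gaussianPDFReal 0 1 s
        = - ∫ s in Ioi t, k s * gaussianPDFReal 0 1 s := by
      have := integral_add_compl (measurableSet_Iic (a := t)) hint
      rw [h0, compl_Iic] at this
      linarith
    rw [hsplit, abs_neg, abs_of_nonneg ht, ← integral_Ioi_id_mul_gaussianPDFReal_std t,
      ← integral_const_mul]
    calc t * |∫ s in Ioi t, k s * gaussianPDFReal 0 1 s|
        ≤ t * ∫ s in Ioi t, |k s * gaussianPDFReal 0 1 s| := by
          gcongr; exact abs_integral_le_integral_abs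
      _ = ∫ s in Ioi t, t * |k s * gaussianPDFReal 0 1 s| := (integral_const_mul _ _).symm
      _ ≤ _ := by
          refine setIntegral_mono_on (hint.abs.const_mul t).integrableOn
            (integrable_id_mul_gaussianPDFReal_std.const_mul B).integrableOn measurableSet_Ioi
            fun s hs => ?_
          rw [abs_mul, abs_of_nonneg (gaussianPDFReal_nonneg 0 1 s)]
          have h1 := gaussianPDFReal_nonneg 0 1 s
          have h2 : t * |k s| ≤ s * B := mul_le_mul (le_of_lt hs) (hB s) (abs_nonneg _)
            (ht.trans (le_of_lt hs))
          nlinarith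
  · rw [abs_of_neg ht, ← neg_neg (gaussianPDFReal 0 1 t),
      ← integral_Iic_id_mul_gaussianPDFReal_std t, ← integral_neg, ← integral_const_mul]
    calc -t * |∫ s in Iic t, k s * gaussianPDFReal 0 1 s|
        ≤ -t * ∫ s in Iic t, |k s * gaussianPDFReal 0 1 s| := by
          gcongr
          · linarith
          · exact abs_integral_le_integral_abs
      _ = ∫ s in Iic t, -t * |k s * gaussianPDFReal 0 1 s| := (integral_const_mul _ _).symm
      _ ≤ _ := by
          refine setIntegral_mono_on (hint.abs.const_mul _).integrableOn
            (integrable_id_mul_gaussianPDFReal_std.neg.const_mul B).integrableOn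
            measurableSet_Iic fun s hs => ?_
          have hs' : s ≤ t := hs
          rw [abs_mul, abs_of_nonneg (gaussianPDFReal_nonneg 0 1 s)]
          have h1 := gaussianPDFReal_nonneg 0 1 s
          have h2 : -t * |k s| ≤ -s * B := mul_le_mul (by linarith) (hB s) (abs_nonneg _)
            (by linarith)
          nlinarith

/-- Solution of Stein's equation `f' t - t f t = h t - 𝔼 h(g)` with bounded derivative. -/
lemma exists_stein_solution {h : ℝ → ℝ} {B : ℝ} (hc : Continuous h) (hB : ∀ t, |h t| ≤ B) :
    ∃ f : ℝ → ℝ, (∀ t, HasDerivAt f (t * f t + (h t - ∫ s, h s ∂(gaussianReal 0 1))) t) ∧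
      ∀ t, |t * f t + (h t - ∫ s, h s ∂(gaussianReal 0 1))| ≤ 4 * B := by
  set c := ∫ s, h s ∂(gaussianReal 0 1) with hcdef
  have hhint : Integrable h (gaussianReal 0 1) :=
    Integrable.of_bound hc.aestronglyMeasurable B (Eventually.of_forall hB)
  have hcB : |c| ≤ B := by
    have := norm_integral_le_of_norm_le_const (μ := gaussianReal 0 1) (f := h) (C := B)
      (Eventually.of_forall hB)
    simpa using this
  set k : ℝ → ℝ := fun t => h t - c with hk
  have hkc : Continuous k := hc.sub continuous_const
  have hkB : ∀ t, |k t| ≤ 2 * B := fun t => by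
    have := abs_sub (h t) c
    have := hB t
    simp only [hk]
    linarith
  have hk0 : ∫ t, k t * gaussianPDFReal 0 1 t = 0 := by
    rw [← integral_gaussianReal_std, hk, integral_sub hhint (integrable_const _)]
    simp [hcdef]
  have hkint : Integrable (fun s => k s * gaussianPDFReal 0 1 s) := by
    rw [← integrable_gaussianReal_std_iff]
    exact Integrable.of_bound hkc.aestronglyMeasurable _ (Eventually.of_forall hkB)
  have hpc : Continuous (gaussianPDFReal 0 1) :=
    continuous_of_hasDerivAt hasDerivAt_gaussianPDFReal_std
  have hkpc : Continuous (fun s => k s * gaussianPDFReal 0 1 s) := hkc.mul hpc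
  have hpne : ∀ t, gaussianPDFReal 0 1 t ≠ 0 := fun t =>
    (gaussianPDFReal_pos 0 1 t one_ne_zero).ne'
  set G : ℝ → ℝ := fun t => ∫ s in Iic t, k s * gaussianPDFReal 0 1 s with hG
  have hGd : ∀ t, HasDerivAt G (k t * gaussianPDFReal 0 1 t) t := fun t => by
    have h1 : G = fun t => G 0 + ∫ s in (0 : ℝ)..t, k s * gaussianPDFReal 0 1 s := by
      ext t
      rw [← intervalIntegral.integral_Iic_sub_Iic hkint.integrableOn hkint.integrableOn]
      simp [hG]
    rw [h1]
    exact (intervalIntegral.integral_hasDerivAt_right (hkpc.intervalIntegrable _ _)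
      (hkpc.stronglyMeasurableAtFilter _ _) hkpc.continuousAt).const_add _
  -- Variation of constants: `p' = -t p` makes `G / p` solve the equation. Its derivative is the sum
  -- of `t f t`, at most `2 * B` by the Mills bound, and of the centred `h`, also at most `2 * B`.
  refine ⟨fun t => G t / gaussianPDFReal 0 1 t, fun t => ?_, fun t => ?_⟩
  · refine ((hGd t).div (hasDerivAt_gaussianPDFReal_std t) (hpne t)).congr_deriv ?_
    have := hpne t
    field_simp
    simp only [hk]
    ring
  · have h1 := abs_mul_abs_integral_Iic_le hkc hkB hk0 t
    have h2 : |t * (G t / gaussianPDFReal 0 1 t)| ≤ 2 * B := by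
      rw [abs_mul, abs_div, abs_of_pos (gaussianPDFReal_pos 0 1 t one_ne_zero), ← mul_div_assoc,
        div_le_iff₀ (gaussianPDFReal_pos 0 1 t one_ne_zero)]
      exact h1
    have h3 : |h t - c| ≤ 2 * B := hkB t
    exact (abs_add_le _ _).trans (by linarith)

end SteinEquation

/-! ### Approximate integration by parts in one variable. -/

section ApproximateIntegrationByParts

variable {ν : Measure ℝ} [IsProbabilityMeasure ν]

/-- The identity is exact for the Gaussian, so it suffices to change measure on both sides.
Subtracting `q s * t`, which has mean zero under both laws, leaves a function bounded by `|x| * M *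
t ^ 2`: this produces the fourth moments and, above all, the factor `|x|`. The `2` comes from `|q'|
≤ M` under the two laws. -/
lemma abs_integral_mul_self_sub_le_of_tvDist {ε M x : ℝ} (hε : tvDist ν (gaussianReal 0 1) ≤ ε)
    (h4 : MemLp (fun t : ℝ => t) 4 ν) (hmean : ∫ t, t ∂ν = 0) {q q' : ℝ → ℝ}
    (hq : ∀ t, HasDerivAt q (q' t) t) (hc : Continuous q') (hM : ∀ t, |q' t| ≤ M) (s : ℝ) :
    |∫ t, q (s + x * t) * t ∂ν - x * ∫ t, q' (s + x * t) ∂ν| ≤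
      |x| * M * √ε * (√(∫ t, t ^ 4 ∂ν) + √(∫ t, t ^ 4 ∂(gaussianReal 0 1)) + 2) := by
  have hM0 : 0 ≤ M := (abs_nonneg _).trans (hM 0)
  have hqs : ∀ t, HasDerivAt (fun t => q (s + x * t)) (x * q' (s + x * t)) t := fun t => by
    have h1 : HasDerivAt (fun t : ℝ => s + x * t) x t := by
      simpa using ((hasDerivAt_id t).const_mul x).const_add s
    exact ((hq (s + x * t)).comp t h1).congr_deriv (mul_comm _ _)
  have hMs : ∀ t, |x * q' (s + x * t)| ≤ |x| * M := fun t => by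
    rw [abs_mul]; gcongr; exact hM _
  have hqc : Continuous q := continuous_of_hasDerivAt hq
  set φ : ℝ → ℝ := fun t => (q (s + x * t) - q s) * t with hφ
  have hφb : ∀ t, |φ t| ≤ |x| * M * t ^ 2 := fun t => by
    have := abs_le_of_abs_deriv_le hqs hMs t 0
    simp only [mul_zero, add_zero, sub_zero] at this
    rw [hφ, abs_mul, ← sq_abs t]
    nlinarith [abs_nonneg t]
  have hφc : Continuous φ := by fun_prop
  have key : ∀ ρ : Measure ℝ, IsProbabilityMeasure ρ → MemLp (fun t : ℝ => t) 4 ρ →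
      ∫ t, t ∂ρ = 0 → MemLp φ 2 ρ ∧ √(∫ t, φ t ^ 2 ∂ρ) ≤ |x| * M * √(∫ t, t ^ 4 ∂ρ) ∧
        ∫ t, φ t ∂ρ = ∫ t, q (s + x * t) * t ∂ρ := by
    intro ρ _ h4 h0
    have i4 : Integrable (fun t : ℝ => t ^ 4) ρ := by
      have := h4.integrable_norm_pow (by norm_num)
      refine this.congr (Filter.Eventually.of_forall fun t => ?_)
      exact Even.pow_abs (by decide : Even 4) t
    have hφ2b : ∀ t, φ t ^ 2 ≤ (|x| * M) ^ 2 * t ^ 4 := fun t => by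
      have := pow_le_pow_left₀ (abs_nonneg _) (hφb t) 2
      rw [sq_abs] at this
      linarith [this]
    have iφ : Integrable (fun t => φ t ^ 2) ρ :=
      (i4.const_mul ((|x| * M) ^ 2)).mono' (hφc.pow 2).aestronglyMeasurable
        (Filter.Eventually.of_forall fun t => by
          rw [Real.norm_eq_abs, abs_of_nonneg (sq_nonneg _)]; exact hφ2b t)
    refine ⟨(memLp_two_iff_integrable_sq hφc.aestronglyMeasurable).2 iφ, ?_, ?_⟩
    · rw [← Real.sqrt_sq (by positivity : 0 ≤ |x| * M), ← Real.sqrt_mul (sq_nonneg _),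
        ← integral_const_mul]
      exact Real.sqrt_le_sqrt (integral_mono iφ (i4.const_mul _) hφ2b)
    · have h2 : MemLp (fun t : ℝ => t) 2 ρ := h4.mono_exponent (by norm_num)
      have i1 : Integrable (fun t => q (s + x * t) * t) ρ :=
        (memLp_of_abs_deriv_le h2 hqs hMs).integrable_mul h2
      have i2 : Integrable (fun t => q s * t) ρ := (h2.integrable one_le_two).const_mul _
      simp only [hφ, sub_mul]
      rw [integral_sub i1 i2, integral_const_mul, h0]
      simp
  obtain ⟨a1, a2, a3⟩ := key ν inferInstance h4 hmean
  obtain ⟨b1, b2, b3⟩ := key (gaussianReal 0 1) inferInstance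
    (memLp_id_gaussianReal_std 4 (by simp)) integral_id_gaussianReal
  have e1 := abs_integral_sub_le_of_tvDist_le hε a1 b1
  have hcs : Continuous fun t => q' (s + x * t) := by fun_prop
  rw [a3, b3, integral_mul_self_gaussianReal_eq_integral_deriv hqs (by fun_prop) hMs,
    integral_const_mul] at e1
  have bd : ∀ ρ : Measure ℝ, IsProbabilityMeasure ρ → MemLp (fun t => q' (s + x * t)) 2 ρ ∧
      √(∫ t, q' (s + x * t) ^ 2 ∂ρ) ≤ M := by
    intro ρ _
    refine ⟨MemLp.of_bound hcs.aestronglyMeasurable M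
      (Filter.Eventually.of_forall fun t => hM _), Real.sqrt_le_iff.2 ⟨hM0, ?_⟩⟩
    have := integral_mono_of_nonneg (μ := ρ) (f := fun t => q' (s + x * t) ^ 2)
      (g := fun _ => M ^ 2) (Filter.Eventually.of_forall fun t => sq_nonneg _)
      (integrable_const _) (Filter.Eventually.of_forall fun t => by
        simpa [sq_abs] using pow_le_pow_left₀ (abs_nonneg _) (hM (s + x * t)) 2)
    simpa using this
  obtain ⟨c1, c2⟩ := bd ν inferInstance
  obtain ⟨d1, d2⟩ := bd (gaussianReal 0 1) inferInstance
  have e2 := abs_integral_sub_le_of_tvDist_le hε c1 d1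
  have hs := Real.sqrt_nonneg ε
  have e2' := mul_le_mul_of_nonneg_left
    (e2.trans (mul_le_mul_of_nonneg_left (add_le_add c2 d2) hs)) (abs_nonneg x)
  have e1' := e1.trans (mul_le_mul_of_nonneg_left (add_le_add a2 b2) hs)
  rw [← abs_mul, mul_sub] at e2'
  rw [abs_sub_comm] at e2'
  refine (abs_sub_le _ _ _).trans ((add_le_add e1' e2').trans (le_of_eq ?_))
  ring

end ApproximateIntegrationByParts

/-! ### Linear forms in independent coordinates: leave-one-out and Stein's method. -/

section IndependentCoordinates

variable {Ω ι : Type*} [MeasurableSpace Ω] {μ : Measure Ω} [IsProbabilityMeasure μ]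

lemma indepFun_sum_erase {μ : Measure Ω} [Fintype ι] [DecidableEq ι] {X : ι → Ω → ℝ} (hX : ∀ i, Measurable (X i))
    (hind : iIndepFun X μ) (x : ι → ℝ) (j : ι) :
    IndepFun (fun ω => ∑ k ∈ Finset.univ.erase j, x k * X k ω) (X j) μ := by
  have h := hind.indepFun_finset (Finset.univ.erase j) {j} (by simp) hX
  have h1 : Measurable fun p : {k // k ∈ Finset.univ.erase j} → ℝ => ∑ k : {k // k ∈ Finset.univ.erase j}, x k * p k := by
    fun_prop
  have h2 : Measurable fun p : {k // k ∈ ({j} : Finset ι)} → ℝ => p ⟨j, by simp⟩ := by fun_prop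
  have h3 := h.comp h1 h2
  convert h3 using 1
  · ext ω
    exact (Finset.sum_coe_sort (Finset.univ.erase j) fun k => x k * X k ω).symm
  · rfl

lemma integral_comp_add_mul_of_indepFun {U V : Ω → ℝ} (hU : Measurable U) (hV : Measurable V)
    (hind : IndepFun U V μ) {F : ℝ → ℝ → ℝ} (hF : Measurable (Function.uncurry F))
    (hint : Integrable (fun ω => F (U ω) (V ω)) μ) :
    Integrable (fun u => ∫ v, F u v ∂(μ.map V)) (μ.map U) ∧
    ∫ ω, F (U ω) (V ω) ∂μ = ∫ u, ∫ v, F u v ∂(μ.map V) ∂(μ.map U) := by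
  have hmap := (indepFun_iff_map_prod_eq_prod_map_map hU.aemeasurable hV.aemeasurable).1 hind
  have hUV : Measurable fun ω => (U ω, V ω) := hU.prodMk hV
  have : IsProbabilityMeasure (μ.map U) := Measure.isProbabilityMeasure_map hU.aemeasurable
  have : IsProbabilityMeasure (μ.map V) := Measure.isProbabilityMeasure_map hV.aemeasurable
  have h1 : Integrable (Function.uncurry F) ((μ.map U).prod (μ.map V)) := by
    rw [← hmap]
    exact (integrable_map_measure hF.aestronglyMeasurable hUV.aemeasurable).2 hint
  refine ⟨h1.integral_prod_left, ?_⟩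
  change ∫ ω, F (U ω) (V ω) ∂μ = ∫ u, ∫ v, Function.uncurry F (u, v) ∂(μ.map V) ∂(μ.map U)
  rw [← integral_prod (Function.uncurry F) h1, ← hmap,
    integral_map hUV.aemeasurable hF.aestronglyMeasurable]
  rfl

variable [Fintype ι] {ν : Measure ℝ}

lemma memLp_sum_mul {μ : Measure Ω} {X : ι → Ω → ℝ} {p : ℝ≥0∞} (hL : ∀ i, MemLp (X i) p μ) (x : ι → ℝ) :
    MemLp (fun ω => ∑ k, x k * X k ω) p μ :=
  memLp_finsetSum _ fun i _ => (hL i).const_mul (x i)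

lemma memLp_of_map_eq {μ : Measure Ω} {X : Ω → ℝ} (hX : Measurable X) (hlaw : μ.map X = ν) {p : ℝ≥0∞}
    (hν : MemLp (fun t : ℝ => t) p ν) : MemLp X p μ := by
  rw [← hlaw] at hν
  exact (memLp_map_measure_iff (by fun_prop) hX.aemeasurable).1 hν

lemma memLp_comp_of_abs_deriv_le {S : Ω → ℝ} (hS : Measurable S) {p : ℝ≥0∞} (hSp : MemLp S p μ)
    {q q' : ℝ → ℝ} {M : ℝ} (hq : ∀ t, HasDerivAt q (q' t) t) (hM : ∀ t, |q' t| ≤ M) :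
    MemLp (fun ω => q (S ω)) p μ := by
  have : IsProbabilityMeasure (μ.map S) := Measure.isProbabilityMeasure_map hS.aemeasurable
  have h := memLp_of_abs_deriv_le (ν := μ.map S)
    ((memLp_map_measure_iff (g := fun t : ℝ => t) (by fun_prop) hS.aemeasurable).2 hSp) hq hM
  exact (memLp_map_measure_iff (continuous_of_hasDerivAt hq).aestronglyMeasurable
    hS.aemeasurable).1 h

variable [IsProbabilityMeasure ν]

/-- The sum over `k ≠ j` is independent of `X j`. With that sum frozen at `s`, the one-variable
estimate holds uniformly in `s` and can be integrated. -/
lemma abs_integral_comp_sum_mul_sub_le {X : ι → Ω → ℝ} (hX : ∀ i, Measurable (X i))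
    (hind : iIndepFun X μ) (hlaw : ∀ i, μ.map (X i) = ν) {ε M : ℝ}
    (hε : tvDist ν (gaussianReal 0 1) ≤ ε) (h4 : MemLp (fun t : ℝ => t) 4 ν)
    (hmean : ∫ t, t ∂ν = 0) {q q' : ℝ → ℝ} (hq : ∀ t, HasDerivAt q (q' t) t)
    (hc : Continuous q') (hM : ∀ t, |q' t| ≤ M) (x : ι → ℝ) (j : ι) :
    |∫ ω, q (∑ k, x k * X k ω) * X j ω ∂μ - x j * ∫ ω, q' (∑ k, x k * X k ω) ∂μ| ≤
      |x j| * M * √ε * (√(∫ t, t ^ 4 ∂ν) + √(∫ t, t ^ 4 ∂(gaussianReal 0 1)) + 2) := by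
  classical
  set U : Ω → ℝ := fun ω => ∑ k ∈ Finset.univ.erase j, x k * X k ω with hUdef
  have hU : Measurable U := by fun_prop
  have hsum : ∀ ω, ∑ k, x k * X k ω = U ω + x j * X j ω := fun ω =>
    (Finset.sum_erase_add _ _ (Finset.mem_univ j)).symm
  have hUX : IndepFun U (X j) μ := indepFun_sum_erase hX hind x j
  have h2 : MemLp (fun t : ℝ => t) 2 ν := h4.mono_exponent (by norm_num)
  have hL : ∀ i, MemLp (X i) 2 μ := fun i => memLp_of_map_eq (hX i) (hlaw i) h2
  have hS : Measurable fun ω => ∑ k, x k * X k ω := by fun_prop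
  have i1 : Integrable (fun ω => q (∑ k, x k * X k ω) * X j ω) μ :=
    (memLp_comp_of_abs_deriv_le hS (memLp_sum_mul hL x) hq hM).integrable_mul (hL j)
  have i2 : Integrable (fun ω => q' (∑ k, x k * X k ω)) μ :=
    Integrable.of_bound (hc.measurable.comp hS).aestronglyMeasurable M
      (Filter.Eventually.of_forall fun ω => hM _)
  have hqc : Continuous q := continuous_of_hasDerivAt hq
  simp only [hsum] at i1 i2 ⊢
  obtain ⟨j1, k1⟩ := integral_comp_add_mul_of_indepFun (F := fun u v => q (u + x j * v) * v)
    hU (hX j) hUX (by unfold Function.uncurry; fun_prop) i1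
  obtain ⟨j2, k2⟩ := integral_comp_add_mul_of_indepFun (F := fun u v => q' (u + x j * v))
    hU (hX j) hUX (by unfold Function.uncurry; fun_prop) i2
  have : IsProbabilityMeasure (μ.map U) := Measure.isProbabilityMeasure_map hU.aemeasurable
  rw [k1, k2, ← integral_const_mul, ← integral_sub j1 (j2.const_mul _)]
  rw [hlaw j]
  have := norm_integral_le_of_norm_le_const (μ := μ.map U)
    (f := fun s => ∫ t, q (s + x j * t) * t ∂ν - x j * ∫ t, q' (s + x j * t) ∂ν)
    (Filter.Eventually.of_forall fun s =>
      (abs_integral_mul_self_sub_le_of_tvDist (x := x j) hε h4 hmean hq hc hM s))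
  simpa using this

/-- Bias estimate: the correlation of a smooth function of a linear form with a coordinate is
that of the Gaussian case up to `√ε`. -/
lemma abs_integral_comp_sum_mul_sub_gaussian_le {X : ι → Ω → ℝ} (hX : ∀ i, Measurable (X i))
    (hind : iIndepFun X μ) (hlaw : ∀ i, μ.map (X i) = ν) {ε M : ℝ}
    (hε : tvDist ν (gaussianReal 0 1) ≤ ε) (h4 : MemLp (fun t : ℝ => t) 4 ν)
    (hmean : ∫ t, t ∂ν = 0) {q q' : ℝ → ℝ} (hq : ∀ t, HasDerivAt q (q' t) t)
    (hc : Continuous q') (hM : ∀ t, |q' t| ≤ M) (x : ι → ℝ) (hx : ∑ k, x k ^ 2 = 1) (j : ι) :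
    |∫ ω, q (∑ k, x k * X k ω) * X j ω ∂μ - x j * ∫ t, q t * t ∂(gaussianReal 0 1)| ≤
      |x j| * (5 * M * √ε *
        (√(∫ t, t ^ 4 ∂ν) + √(∫ t, t ^ 4 ∂(gaussianReal 0 1)) + 2)) := by
  set c₀ := √(∫ t, t ^ 4 ∂ν) + √(∫ t, t ^ 4 ∂(gaussianReal 0 1)) + 2 with hc₀
  obtain ⟨f, hf, hfM⟩ := exists_stein_solution hc hM
  set c := ∫ s, q' s ∂(gaussianReal 0 1) with hcdef
  have hfc : Continuous f := continuous_of_hasDerivAt hf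
  have h2 : MemLp (fun t : ℝ => t) 2 ν := h4.mono_exponent (by norm_num)
  have hL : ∀ i, MemLp (X i) 2 μ := fun i => memLp_of_map_eq (hX i) (hlaw i) h2
  have hS : Measurable fun ω => ∑ k, x k * X k ω := by fun_prop
  have hf2 := memLp_comp_of_abs_deriv_le hS (memLp_sum_mul hL x) hf hfM
  have if' : ∀ k, Integrable (fun ω => f (∑ k, x k * X k ω) * X k ω) μ := fun k =>
    hf2.integrable_mul (hL k)
  set f' : ℝ → ℝ := fun t => t * f t + (q' t - c) with hf'
  have hf'c : Continuous f' := by fun_prop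
  have hk := fun k => abs_integral_comp_sum_mul_sub_le hX hind hlaw hε h4 hmean hf hf'c hfM x k
  have iS : Integrable (fun ω => (∑ k, x k * X k ω) * f (∑ k, x k * X k ω)) μ :=
    (memLp_sum_mul hL x).integrable_mul hf2
  have iq : Integrable (fun ω => q' (∑ k, x k * X k ω)) μ :=
    Integrable.of_bound (hc.measurable.comp hS).aestronglyMeasurable M
      (Filter.Eventually.of_forall fun ω => hM _)
  -- With `S` the linear form and `∑ x k ^ 2 = 1`, the weighted discrepancies add up to `𝔼 S f(S) -
  -- 𝔼 f'(S)`, which Stein's equation identifies with the error in replacing `S` by a Gaussian in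
  -- `q'`.
  have e1 : ∑ k, x k * (∫ ω, f (∑ k, x k * X k ω) * X k ω ∂μ
      - x k * ∫ ω, f' (∑ k, x k * X k ω) ∂μ) = - (∫ ω, q' (∑ k, x k * X k ω) ∂μ - c) := by
    have a1 : ∫ ω, f' (∑ k, x k * X k ω) ∂μ
        = ∫ ω, (∑ k, x k * X k ω) * f (∑ k, x k * X k ω) ∂μ
          + (∫ ω, q' (∑ k, x k * X k ω) ∂μ - c) := by
      simp only [hf']
      have iqc : Integrable (fun ω => q' (∑ k, x k * X k ω) - c) μ := iq.sub (integrable_const c)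
      rw [integral_add iS iqc, integral_sub iq (integrable_const c)]
      simp
    have a2 : ∫ ω, (∑ k, x k * X k ω) * f (∑ k, x k * X k ω) ∂μ
        = ∑ k, x k * ∫ ω, f (∑ k, x k * X k ω) * X k ω ∂μ := by
      simp only [← integral_const_mul]
      rw [← integral_finsetSum _ fun k _ => (if' k).const_mul (x k)]
      congr 1; ext ω
      rw [Finset.sum_mul]
      exact Finset.sum_congr rfl fun k _ => by ring
    simp only [mul_sub, ← mul_assoc, ← pow_two, Finset.sum_sub_distrib, ← Finset.sum_mul, hx]
    rw [a1, a2]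
    ring
  have hMc : 0 ≤ M * √ε * c₀ := by
    have : 0 ≤ M := (abs_nonneg _).trans (hM 0)
    positivity
  have e2 : |∫ ω, q' (∑ k, x k * X k ω) ∂μ - c| ≤ 4 * M * √ε * c₀ := by
    rw [← abs_neg, ← e1]
    refine (Finset.abs_sum_le_sum_abs _ _).trans ?_
    -- Each discrepancy already carries `|x k|`, so the weights are `x k ^ 2` and sum to `1` in
    -- every dimension. The `4` is the Stein bound on `f'`; a further `1` from `e3` makes the final
    -- `5`.
    calc _ ≤ ∑ k, x k ^ 2 * (4 * M * √ε * c₀) := by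
          refine Finset.sum_le_sum fun k _ => ?_
          rw [abs_mul, ← sq_abs (x k)]
          have := mul_le_mul_of_nonneg_left (hk k) (abs_nonneg (x k))
          refine this.trans (le_of_eq (by ring))
      _ = _ := by rw [← Finset.sum_mul, hx, one_mul]
  have e3 := abs_integral_comp_sum_mul_sub_le hX hind hlaw hε h4 hmean hq hc hM x j
  rw [integral_mul_self_gaussianReal_eq_integral_deriv hq hc hM, ← hcdef]
  have e4 := mul_le_mul_of_nonneg_left e2 (abs_nonneg (x j))
  rw [← abs_mul, mul_sub] at e4
  refine (abs_sub_le _ _ _).trans ((add_le_add e3 e4).trans (le_of_eq ?_))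
  ring

end IndependentCoordinates

/-! ### The convex order and its stability under linear maps and convolution. -/

section ConvexDomination

/-- `ρ` is dominated by `σ` in the convex order (tested on nonnegative continuous convex
functions). -/
def ConvexDominated {E : Type*} [NormedAddCommGroup E] [NormedSpace ℝ E] [MeasurableSpace E]
    (ρ σ : Measure E) : Prop :=
  ∀ Ψ : E → ℝ, ConvexOn ℝ Set.univ Ψ → Continuous Ψ → (∀ x, 0 ≤ Ψ x) →
    ∫⁻ x, ENNReal.ofReal (Ψ x) ∂ρ ≤ ∫⁻ x, ENNReal.ofReal (Ψ x) ∂σ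

variable {E F : Type*} [NormedAddCommGroup E] [NormedSpace ℝ E]
  [NormedAddCommGroup F] [NormedSpace ℝ F]

lemma convexOn_comp_continuousLinearMap {Ψ : F → ℝ} (hΨ : ConvexOn ℝ Set.univ Ψ) (L : E →L[ℝ] F) :
    ConvexOn ℝ Set.univ fun x => Ψ (L x) :=
  hΨ.comp_linearMap L.toLinearMap

lemma convexOn_comp_add_left {Ψ : E → ℝ} (hΨ : ConvexOn ℝ Set.univ Ψ) (x : E) :
    ConvexOn ℝ Set.univ fun y => Ψ (x + y) :=
  hΨ.translate_right x

variable [MeasurableSpace E] [MeasurableSpace F]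

lemma convexDominated_refl (ρ : Measure E) : ConvexDominated ρ ρ := fun _ _ _ _ => le_rfl

variable [BorelSpace E] [BorelSpace F]

lemma ConvexDominated.map {ρ σ : Measure E} (h : ConvexDominated ρ σ) (L : E →L[ℝ] F) :
    ConvexDominated (ρ.map L) (σ.map L) := fun Ψ hΨ hc h0 => by
  have hm : Measurable fun x => ENNReal.ofReal (Ψ x) := hc.measurable.ennreal_ofReal
  rw [lintegral_map hm L.continuous.measurable, lintegral_map hm L.continuous.measurable]
  exact h (fun x => Ψ (L x)) (convexOn_comp_continuousLinearMap hΨ L) (hc.comp L.continuous)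
    fun x => h0 _

/-- Translates of a convex function are convex, so one factor can be replaced while the other
variable is frozen; Tonelli then allows replacing the second. Nonnegative test functions avoid any
integrability condition. -/
lemma ConvexDominated.conv [SecondCountableTopology E] {ρ σ ρ' σ' : Measure E} [SFinite ρ]
    [SFinite σ] [SFinite ρ'] [SFinite σ'] (h : ConvexDominated ρ σ) (h' : ConvexDominated ρ' σ') :
    ConvexDominated (ρ ∗ ρ') (σ ∗ σ') := fun Ψ hΨ hc h0 => by
  have hm : Measurable fun x => ENNReal.ofReal (Ψ x) := hc.measurable.ennreal_ofReal
  have hm2 : Measurable fun p : E × E => ENNReal.ofReal (Ψ (p.1 + p.2)) := by fun_prop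
  have hconv := convexOn_comp_add_left hΨ
  rw [Measure.lintegral_conv hm, Measure.lintegral_conv hm]
  calc ∫⁻ x, ∫⁻ y, ENNReal.ofReal (Ψ (x + y)) ∂ρ' ∂ρ
      ≤ ∫⁻ x, ∫⁻ y, ENNReal.ofReal (Ψ (x + y)) ∂σ' ∂ρ :=
        lintegral_mono fun x => h' _ (hconv x) (by fun_prop) fun y => h0 _
    _ = ∫⁻ y, ∫⁻ x, ENNReal.ofReal (Ψ (x + y)) ∂ρ ∂σ' := lintegral_lintegral_swap hm2.aemeasurable
    _ ≤ ∫⁻ y, ∫⁻ x, ENNReal.ofReal (Ψ (x + y)) ∂σ ∂σ' :=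
        lintegral_mono fun y => h (fun x => Ψ (x + y))
          (by simpa [add_comm] using hconv y) (by fun_prop) fun x => h0 _
    _ = ∫⁻ x, ∫⁻ y, ENNReal.ofReal (Ψ (x + y)) ∂σ' ∂σ :=
        (lintegral_lintegral_swap hm2.aemeasurable).symm

/-- Used twice: to assemble a vector from its coordinates and to add up the measurements. The family
`τ` abstracts the laws of the dominating partial sums. -/
lemma convexDominated_map_sum {Ω ι : Type*} [MeasurableSpace Ω] {μ : Measure Ω}
    [IsProbabilityMeasure μ] [SecondCountableTopology E] [DecidableEq ι]
    {X : ι → Ω → E} (hX : ∀ i, Measurable (X i)) (hind : iIndepFun X μ) {σ : ι → Measure E}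
    {τ : Finset ι → Measure E} [∀ i, IsProbabilityMeasure (σ i)] [∀ s, IsProbabilityMeasure (τ s)]
    (hdom : ∀ i, ConvexDominated (μ.map (X i)) (σ i)) (hempty : τ ∅ = Measure.dirac 0)
    (hinsert : ∀ s i, i ∉ s → τ s ∗ σ i = τ (insert i s)) (s : Finset ι) :
    ConvexDominated (μ.map (∑ i ∈ s, X i)) (τ s) := by
  have hsum : ∀ s : Finset ι, Measurable (∑ i ∈ s, X i) := fun s => by
    convert Finset.measurable_sum s fun i _ => hX i using 1
    ext ω; simp
  have hp : ∀ {f : Ω → E}, Measurable f → IsProbabilityMeasure (μ.map f) := fun hf =>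
    Measure.isProbabilityMeasure_map hf.aemeasurable
  induction s using Finset.induction_on with
  | empty =>
    rw [hempty, Finset.sum_empty]
    have : μ.map (0 : Ω → E) = Measure.dirac 0 := by
      rw [show (0 : Ω → E) = fun _ => 0 from rfl, Measure.map_const]; simp
    rw [this]
    exact convexDominated_refl _
  | insert i s hi ih =>
    have := hp (hX i)
    have := hp (hsum s)
    rw [Finset.sum_insert hi, add_comm,
      (hind.indepFun_finsetSum_of_notMem hX hi).map_add_eq_map_conv_map₀'
      (hsum s).aemeasurable (hX i).aemeasurable inferInstance inferInstance]
    convert ih.conv (hdom i) using 1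
    exact (hinsert s i hi).symm

end ConvexDomination

/-! ### From a tail comparison to convex domination on the line. -/

section OneDimensional

open Set

/-- Layer cake: superlevel sets of an increasing function of `|t|` are tail sets, to which `htail`
applies level by level. -/
lemma lintegral_comp_abs_le_of_tail {ν γ : Measure ℝ} {K : ℝ≥0∞} (hK : K ≠ ∞) {σ : ℝ} (hσ : 0 ≤ σ)
    (htail : ∀ u, 0 ≤ u → ν {t | u ≤ |t|} ≤ K * γ {t | u ≤ σ * |t|}) {h : ℝ → ℝ}
    (hmono : MonotoneOn h (Ici 0)) (hc : Continuous h) (h0 : h 0 = 0) :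
    ∫⁻ t, ENNReal.ofReal (h |t|) ∂ν ≤ K * ∫⁻ t, ENNReal.ofReal (h (σ * |t|)) ∂γ := by
  have hnn : ∀ u, 0 ≤ u → 0 ≤ h u := fun u hu => h0 ▸ hmono self_mem_Ici hu hu
  rw [lintegral_eq_lintegral_meas_le ν (Filter.Eventually.of_forall fun t => hnn _ (abs_nonneg t))
      (by fun_prop),
    lintegral_eq_lintegral_meas_le γ
      (Filter.Eventually.of_forall fun t => hnn _ (mul_nonneg hσ (abs_nonneg t))) (by fun_prop),
    ← lintegral_const_mul' _ _ hK]
  refine setLIntegral_mono' measurableSet_Ioi fun t _ => ?_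
  -- The infimum of `U` is the smallest radius at which `h` reaches the level `t`; it is attained
  -- because `U` is closed.
  set U : Set ℝ := {u | 0 ≤ u ∧ t ≤ h u} with hU
  have hUc : IsClosed U := (isClosed_le continuous_const continuous_id).inter
    (isClosed_le continuous_const hc)
  have hUb : BddBelow U := ⟨0, fun u hu => hu.1⟩
  rcases U.eq_empty_or_nonempty with hE | hN
  · have : {s : ℝ | t ≤ h |s|} = ∅ := by
      refine eq_empty_of_forall_notMem fun s hs => ?_
      have : |s| ∈ U := ⟨abs_nonneg s, hs⟩
      rw [hE] at this
      exact this
    rw [this]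
    simp
  · have hmem := hUc.csInf_mem hN hUb
    calc ν {s | t ≤ h |s|} ≤ ν {s | sInf U ≤ |s|} :=
          measure_mono fun s hs => csInf_le hUb ⟨abs_nonneg s, hs⟩
      _ ≤ K * γ {s | sInf U ≤ σ * |s|} := htail _ hmem.1
      _ ≤ _ := by
          refine mul_le_mul_right (measure_mono fun s hs => ?_) _
          exact hmem.2.trans (hmono hmem.1 (hmem.1.trans hs) hs)

/-- By symmetry `Ψ` may be replaced by `H u = Ψ u + Ψ (-u)`, which is even and convex, hence
increasing on `[0, ∞)`. The tail comparison costs a factor `K` in front of the integral, and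
convexity turns it into a dilation: `K * (H u - H 0) ≤ H (K * u) - H 0`. -/
lemma convexDominated_of_tail {ν γ : Measure ℝ} [IsProbabilityMeasure ν] [IsProbabilityMeasure γ]
    (hν : ν.map (fun t => -t) = ν) (hγ : γ.map (fun t => -t) = γ) {K σ : ℝ} (hK : 1 ≤ K)
    (hσ : 0 ≤ σ)
    (htail : ∀ u, 0 ≤ u → ν {t | u ≤ |t|} ≤ ENNReal.ofReal K * γ {t | u ≤ σ * |t|}) :
    ConvexDominated ν (γ.map fun t => (K * σ) * t) := by
  intro Ψ hΨ hc hpos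
  set H : ℝ → ℝ := fun u => Ψ u + Ψ (-u) with hH
  have hHc : Continuous H := by fun_prop
  have hHconv : ConvexOn ℝ univ H :=
    hΨ.add (convexOn_comp_continuousLinearMap hΨ (-ContinuousLinearMap.id ℝ ℝ))
  have hHeven : ∀ u, H (-u) = H u := fun u => by simp [hH, add_comm]
  have hHabs : ∀ u, H |u| = H u := fun u => by
    rcases abs_choice u with h | h <;> rw [h]
    exact hHeven u
  have hHmono : MonotoneOn H (Ici 0) := fun a ha b hb hab => by
    have ha' : (0 : ℝ) ≤ a := ha
    have := hHconv.le_max_of_mem_Icc (mem_univ (-b)) (mem_univ b) (z := a)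
      ⟨by linarith, hab⟩
    rwa [hHeven, max_self] at this
  have hsym : ∀ ρ : Measure ℝ, ρ.map (fun t => -t) = ρ → ∀ c : ℝ,
      2 * ∫⁻ t, ENNReal.ofReal (Ψ (c * t)) ∂ρ = ∫⁻ t, ENNReal.ofReal (H (c * t)) ∂ρ := by
    intro ρ hρ c
    have h1 : ∫⁻ t, ENNReal.ofReal (Ψ (c * t)) ∂ρ = ∫⁻ t, ENNReal.ofReal (Ψ (-(c * t))) ∂ρ := by
      conv_lhs => rw [← hρ]
      rw [lintegral_map (by fun_prop) (by fun_prop)]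
      simp
    simp only [hH, ENNReal.ofReal_add (hpos _) (hpos _)]
    rw [lintegral_add_left (by fun_prop), ← h1, two_mul]
  have hH0 : 0 ≤ H 0 := add_nonneg (hpos _) (hpos _)
  have hge : ∀ u, H 0 ≤ H u := fun u => by
    rw [← hHabs u]; exact hHmono self_mem_Ici (abs_nonneg u) (abs_nonneg u)
  have hmul : ∀ u, K * (H u - H 0) ≤ H (K * u) - H 0 := fun u => by
    have hK0 : (0 : ℝ) < K := by linarith
    have h1 := hHconv.2 (mem_univ (K * u)) (mem_univ 0)
      (by positivity : 0 ≤ K⁻¹)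
      (sub_nonneg.2 (inv_le_one_of_one_le₀ hK)) (by ring)
    simp only [smul_eq_mul, mul_zero, add_zero, inv_mul_cancel_left₀ hK0.ne'] at h1
    have h2 := mul_le_mul_of_nonneg_left h1 hK0.le
    have h3 : K * (K⁻¹ * H (K * u) + (1 - K⁻¹) * H 0) = H (K * u) + (K - 1) * H 0 := by
      field_simp
    rw [h3] at h2
    linarith
  have key := lintegral_comp_abs_le_of_tail ENNReal.ofReal_ne_top hσ htail
    (h := fun u => H u - H 0) (fun a ha b hb hab => sub_le_sub_right (hHmono ha hb hab) _)
    (by fun_prop) (sub_self _)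
  have e1 : ∫⁻ t, ENNReal.ofReal (H t) ∂ν
      = ENNReal.ofReal (H 0) + ∫⁻ t, ENNReal.ofReal (H |t| - H 0) ∂ν := by
    have : ∀ t, ENNReal.ofReal (H t) = ENNReal.ofReal (H 0) + ENNReal.ofReal (H |t| - H 0) :=
      fun t => by
        rw [← ENNReal.ofReal_add hH0 (sub_nonneg.2 (hge _)), hHabs]; congr 1; ring
    rw [lintegral_congr this, lintegral_add_left (by fun_prop)]
    simp
  have e2 : ENNReal.ofReal (H 0) + ENNReal.ofReal K * ∫⁻ t, ENNReal.ofReal (H (σ * |t|) - H 0) ∂γ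
      ≤ ∫⁻ t, ENNReal.ofReal (H (K * σ * t)) ∂γ := by
    have h1 : ENNReal.ofReal (H 0) = ∫⁻ _, ENNReal.ofReal (H 0) ∂γ := by simp
    rw [h1, ← lintegral_const_mul' _ _ ENNReal.ofReal_ne_top, ← lintegral_add_left (by fun_prop)]
    refine lintegral_mono fun t => ?_
    rw [← ENNReal.ofReal_mul (by linarith),
      ← ENNReal.ofReal_add hH0 (mul_nonneg (by linarith) (sub_nonneg.2 (hge _)))]
    refine ENNReal.ofReal_le_ofReal ?_
    have h2 := hmul (σ * |t|)
    have h3 : H (K * (σ * |t|)) = H (K * σ * t) := by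
      rw [← hHabs (K * σ * t), abs_mul, abs_of_nonneg (mul_nonneg (by linarith) hσ), mul_assoc]
    rw [← h3]
    linarith
  rw [lintegral_map (by fun_prop) (by fun_prop)]
  have f1 := hsym ν hν 1
  simp only [one_mul] at f1
  have f2 : 2 * ∫⁻ t, ENNReal.ofReal (Ψ t) ∂ν ≤ 2 * ∫⁻ t, ENNReal.ofReal (Ψ (K * σ * t)) ∂γ := by
    rw [f1, hsym γ hγ, e1]
    exact (add_le_add_right key _).trans e2
  exact (ENNReal.mul_le_mul_iff_right two_ne_zero (by simp)).1 f2

end OneDimensional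

/-! ### Sub-gaussian tails against Gaussian tails. -/

section SubgaussianTail

variable {Ω : Type*} [MeasurableSpace Ω] {P : Measure Ω} {a : Ω → ℝ}

lemma eLpNorm_le_of_subgaussianNorm_lt_top (hκ : subgaussianNorm a P < ∞) {p : ℝ} (hp : 1 ≤ p) :
    eLpNorm a (ENNReal.ofReal p) P ≤ ENNReal.ofReal ((subgaussianNorm a P).toReal * √p) := by
  have hp0 : 0 < p := by linarith
  have h1 : ENNReal.ofReal (p ^ (-(1 / 2) : ℝ)) * eLpNorm a (ENNReal.ofReal p) P
      ≤ subgaussianNorm a P :=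
    le_iSup₂ (f := fun (p : ℝ) (_ : 1 ≤ p) =>
      ENNReal.ofReal (p ^ (-(1 / 2) : ℝ)) * eLpNorm a (ENNReal.ofReal p) P) p hp
  have h2 : ENNReal.ofReal √p * ENNReal.ofReal (p ^ (-(1 / 2) : ℝ)) = 1 := by
    rw [← ENNReal.ofReal_mul (Real.sqrt_nonneg _), Real.sqrt_eq_rpow, ← Real.rpow_add hp0]
    simp
  calc eLpNorm a (ENNReal.ofReal p) P
      = ENNReal.ofReal √p * (ENNReal.ofReal (p ^ (-(1 / 2) : ℝ)) *
          eLpNorm a (ENNReal.ofReal p) P) := by rw [← mul_assoc, h2, one_mul]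
    _ ≤ ENNReal.ofReal √p * subgaussianNorm a P := by gcongr
    _ = _ := by
        rw [mul_comm, ENNReal.ofReal_mul ENNReal.toReal_nonneg, ENNReal.ofReal_toReal hκ.ne]

lemma memLp_of_subgaussianNorm_lt_top (ha : Measurable a) (hκ : subgaussianNorm a P < ∞) {p : ℝ}
    (hp : 1 ≤ p) : MemLp a (ENNReal.ofReal p) P :=
  ⟨ha.aestronglyMeasurable,
    (eLpNorm_le_of_subgaussianNorm_lt_top hκ hp).trans_lt ENNReal.ofReal_lt_top⟩

/-- Markov's inequality for the moment of order `p = s ^ 2`, where `s = u / (e κ)`: then `(κ √p / u)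
^ p = exp (-p)`. This needs `s ≥ 1`; for `s < 1` the prefactor `e` makes the bound trivial. -/
lemma measure_le_abs_le_of_subgaussianNorm [IsProbabilityMeasure P] (ha : Measurable a)
    (hκ : subgaussianNorm a P < ∞) (hκ0 : 0 < (subgaussianNorm a P).toReal) {u : ℝ} (hu : 0 ≤ u) :
    P {ω | u ≤ |a ω|} ≤ ENNReal.ofReal
      (Real.exp 1 * Real.exp (-(u / (Real.exp 1 * (subgaussianNorm a P).toReal)) ^ 2)) := by
  set κ := (subgaussianNorm a P).toReal with hκdef
  set s := u / (Real.exp 1 * κ) with hs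
  have he := Real.exp_pos 1
  have hs0 : 0 ≤ s := by positivity
  rcases le_or_gt 1 s with h1 | h1
  · have hp : (1 : ℝ) ≤ s ^ 2 := one_le_pow₀ h1
    have hu0 : 0 < u := by
      rcases hu.eq_or_lt with h | h
      · rw [hs, ← h, zero_div] at h1; linarith
      · exact h
    have hL := eLpNorm_le_of_subgaussianNorm_lt_top hκ hp
    rw [Real.sqrt_sq hs0] at hL
    have hM := meas_ge_le_mul_pow_eLpNorm_enorm (p := ENNReal.ofReal (s ^ 2)) P
      (by simp; positivity) (by simp) ha.aestronglyMeasurable (ε := ENNReal.ofReal u)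
      (by simpa using hu0) (by simp)
    rw [ENNReal.toReal_ofReal (by positivity)] at hM
    have hset : {ω | u ≤ |a ω|} = {ω | ENNReal.ofReal u ≤ ‖a ω‖ₑ} := by
      ext ω
      rw [Set.mem_ofPred_eq, Set.mem_ofPred_eq, Real.enorm_eq_ofReal_abs,
        ENNReal.ofReal_le_ofReal_iff (abs_nonneg _)]
    rw [hset]
    refine hM.trans ?_
    have hsu : u⁻¹ * (κ * s) = Real.exp (-1) := by
      rw [hs, Real.exp_neg]; field_simp
    calc _ ≤ (ENNReal.ofReal u)⁻¹ ^ (s ^ 2) * ENNReal.ofReal (κ * s) ^ (s ^ 2) := by gcongr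
      _ = ENNReal.ofReal (Real.exp (-1) ^ (s ^ 2)) := by
          rw [← ENNReal.mul_rpow_of_nonneg _ _ (by positivity), ← ENNReal.ofReal_inv_of_pos hu0,
            ← ENNReal.ofReal_mul (by positivity), hsu,
            ENNReal.ofReal_rpow_of_nonneg (Real.exp_pos _).le (by positivity)]
      _ ≤ _ := by
          refine ENNReal.ofReal_le_ofReal ?_
          rw [← Real.exp_mul, neg_one_mul]
          exact le_mul_of_one_le_left (Real.exp_pos _).le (Real.one_le_exp zero_le_one)
  · refine prob_le_one.trans ?_
    rw [← ENNReal.ofReal_one, ← Real.exp_add]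
    refine ENNReal.ofReal_le_ofReal (Real.one_le_exp ?_)
    nlinarith

/-- The density is integrated over `[t, t + 1]` only, using `(t + 1) ^ 2 / 2 ≤ t ^ 2 + 1`. -/
lemma le_gaussianReal_le_abs {t : ℝ} (ht : 0 ≤ t) :
    ENNReal.ofReal ((√(2 * Real.pi))⁻¹ * Real.exp (-1) * Real.exp (-t ^ 2)) ≤
      gaussianReal 0 1 {s | t ≤ |s|} := by
  calc _ ≤ ∫⁻ _ in Set.Icc t (t + 1),
          ENNReal.ofReal ((√(2 * Real.pi))⁻¹ * Real.exp (-1) * Real.exp (-t ^ 2)) := by simp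
    _ ≤ ∫⁻ s in Set.Icc t (t + 1), gaussianPDF 0 1 s := by
        refine setLIntegral_mono' measurableSet_Icc fun s hs => ?_
        rw [gaussianPDF, gaussianPDFReal_std]
        refine ENNReal.ofReal_le_ofReal ?_
        rw [mul_assoc, ← Real.exp_add]
        refine mul_le_mul_of_nonneg_left (Real.exp_le_exp.2 ?_) (by positivity)
        have := hs.2
        have : s ^ 2 ≤ (t + 1) ^ 2 := pow_le_pow_left₀ (ht.trans hs.1) hs.2 2
        nlinarith [sq_nonneg (t - 1)]
    _ = gaussianReal 0 1 (Set.Icc t (t + 1)) := (gaussianReal_apply 0 one_ne_zero _).symm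
    _ ≤ _ := measure_mono fun s hs => hs.1.trans (le_abs_self s)

/-- The ratio of the prefactor `e` of the sub-gaussian upper bound to the prefactor `1 / (e √(2π))`
of the Gaussian lower bound; this is the source of the constant `20`. -/
lemma exp_one_sq_mul_sqrt_two_pi_le : Real.exp 1 ^ 2 * √(2 * Real.pi) ≤ 20 := by
  have h1 : √(2 * Real.pi) ≤ 2.6 := by
    rw [Real.sqrt_le_iff]
    have := Real.pi_lt_d2
    exact ⟨by norm_num, by nlinarith⟩
  have h2 := Real.exp_one_lt_d9
  have h3 := Real.exp_pos 1
  have h4 : Real.exp 1 ^ 2 ≤ 7.4 := by nlinarith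
  have := mul_le_mul h4 h1 (Real.sqrt_nonneg _) (by norm_num)
  linarith

lemma convexDominated_gaussian_of_subgaussianNorm [IsProbabilityMeasure P] (ha : Measurable a)
    (hsym : IdentDistrib a (-a) P P) (hκ : subgaussianNorm a P < ∞)
    (hκ0 : 0 < (subgaussianNorm a P).toReal) :
    ConvexDominated (P.map a) ((gaussianReal 0 1).map
      fun t => (20 * (Real.exp 1 * (subgaussianNorm a P).toReal)) * t) := by
  have : IsProbabilityMeasure (P.map a) := Measure.isProbabilityMeasure_map ha.aemeasurable
  have he := Real.exp_pos 1
  set σ := Real.exp 1 * (subgaussianNorm a P).toReal with hσ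
  have hσ0 : 0 < σ := by positivity
  refine convexDominated_of_tail ?_ ?_ (by norm_num) hσ0.le fun u hu => ?_
  · rw [Measure.map_map (by fun_prop) ha]
    exact hsym.map_eq.symm
  · rw [gaussianReal_map_neg, neg_zero]
  · rw [Measure.map_apply ha (measurableSet_le measurable_const (by fun_prop))]
    refine (measure_le_abs_le_of_subgaussianNorm ha hκ hκ0 hu).trans ?_
    have hset : {t : ℝ | u ≤ σ * |t|} = {t | u / σ ≤ |t|} := by
      ext t; simp only [Set.mem_ofPred_eq]; rw [div_le_iff₀' hσ0]
    rw [hset]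
    refine le_trans ?_ (mul_le_mul_right (le_gaussianReal_le_abs (by positivity)) _)
    rw [← ENNReal.ofReal_mul (by norm_num)]
    refine ENNReal.ofReal_le_ofReal ?_
    rw [← mul_assoc]
    refine mul_le_mul_of_nonneg_right ?_ (Real.exp_pos _).le
    rw [Real.exp_neg]
    have h2 : 0 < √(2 * Real.pi) := by positivity
    have := exp_one_sq_mul_sqrt_two_pi_le
    rw [← mul_assoc, ← div_eq_mul_inv, ← div_eq_mul_inv, le_div_iff₀ he, le_div_iff₀ h2]
    linarith

end SubgaussianTail

/-! ### Domination by Gaussian vectors. -/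

section GaussianVectors

variable {n : ℕ}

lemma stdGaussian_eq_map_sum_basis :
    stdGaussian (EuclideanSpace ℝ (Fin n)) = (Measure.pi fun _ : Fin n => gaussianReal 0 1).map
      fun x => ∑ j, x j • EuclideanSpace.basisFun (Fin n) ℝ j :=
  stdGaussian_eq_map_pi_orthonormalBasis _

/-- The vector is a sum of independent vectors along the basis directions, each dominated by a
Gaussian multiple of its direction. The family `τ` is taken to be the laws of partial sums of a
model Gaussian vector. -/
lemma convexDominated_stdGaussian_of_coordinates {Ω : Type*} [MeasurableSpace Ω] {μ : Measure Ω}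
    [IsProbabilityMeasure μ] {A : Ω → EuclideanSpace ℝ (Fin n)} (hA : Measurable A)
    (hind : iIndepFun (fun j ω => A ω j) μ) {c : ℝ}
    (hdom : ∀ j, ConvexDominated (μ.map fun ω => A ω j) ((gaussianReal 0 1).map fun t => c * t)) :
    ConvexDominated (μ.map A) ((stdGaussian (EuclideanSpace ℝ (Fin n))).map fun x => c • x) := by
  set e := EuclideanSpace.basisFun (Fin n) ℝ with he
  have hcoord : ∀ j, Measurable fun ω => A ω j := fun j => by fun_prop
  have hsmul : ∀ j, Measurable fun t : ℝ => t • e j := fun j => by fun_prop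
  have hcm : Measurable fun t : ℝ => c * t := by fun_prop
  have hp1 : ∀ j, IsProbabilityMeasure (((gaussianReal 0 1).map fun t => c * t).map
      fun t : ℝ => t • e j) := fun j => by
    have := Measure.isProbabilityMeasure_map (μ := gaussianReal 0 1) hcm.aemeasurable
    exact Measure.isProbabilityMeasure_map (hsmul j).aemeasurable
  set X : Fin n → (Fin n → ℝ) → EuclideanSpace ℝ (Fin n) := fun j g => (c * g j) • e j with hX
  have hXm : ∀ j, Measurable (X j) := fun j => by fun_prop
  have hXs : ∀ s : Finset (Fin n), Measurable (∑ j ∈ s, X j) := fun s => by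
    convert Finset.measurable_sum s fun i _ => hXm i using 1
    ext1 ω; simp
  have hp2 : ∀ s : Finset (Fin n), IsProbabilityMeasure
      ((Measure.pi fun _ : Fin n => gaussianReal 0 1).map (∑ j ∈ s, X j)) := fun s =>
    Measure.isProbabilityMeasure_map (hXs s).aemeasurable
  have hXind : iIndepFun X (Measure.pi fun _ : Fin n => gaussianReal 0 1) :=
    iIndepFun_pi (X := fun j (t : ℝ) => (c * t) • e j) fun j => by fun_prop
  have hXlaw : ∀ j, (Measure.pi fun _ : Fin n => gaussianReal 0 1).map (X j)
      = ((gaussianReal 0 1).map fun t => c * t).map fun t : ℝ => t • e j := fun j => by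
    rw [Measure.map_map (hsmul j) hcm]
    have h1 := (measurePreserving_eval (fun _ : Fin n => gaussianReal 0 1) j).map_eq
    conv_rhs => rw [← h1]
    rw [Measure.map_map (by fun_prop) (by fun_prop)]
    rfl
  have main := convexDominated_map_sum (X := fun j ω => A ω j • e j)
    (fun j => (hsmul j).comp (hcoord j)) (hind.comp (fun j t => t • e j) hsmul)
    (σ := fun j => ((gaussianReal 0 1).map fun t => c * t).map fun t : ℝ => t • e j)
    (τ := fun s => (Measure.pi fun _ : Fin n => gaussianReal 0 1).map (∑ j ∈ s, X j))
    (fun j => by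
      have := (hdom j).map (ContinuousLinearMap.toSpanSingleton ℝ (e j))
      rw [Measure.map_map (by fun_prop) (hcoord j)] at this
      exact this)
    (by
      rw [Finset.sum_empty, show (0 : (Fin n → ℝ) → EuclideanSpace ℝ (Fin n)) = fun _ => 0 from rfl,
        Measure.map_const]
      simp)
    (fun s i hi => by
      rw [← hXlaw i, ← (hXind.indepFun_finsetSum_of_notMem hXm hi).map_add_eq_map_conv_map₀'
        (hXs s).aemeasurable (hXm i).aemeasurable (have := hp2 s; inferInstance)
        (by rw [hXlaw i]; have := hp1 i; infer_instance), Finset.sum_insert hi, add_comm])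
    Finset.univ
  have e1 : (∑ j, fun ω => A ω j • e j) = A := by
    ext1 ω
    simpa [he] using (EuclideanSpace.basisFun (Fin n) ℝ).sum_repr (A ω)
  have e2 : (∑ j, X j) = (fun x => c • x) ∘ fun x : Fin n → ℝ => ∑ j, x j • e j := by
    ext1 g
    simp [hX, Finset.smul_sum, mul_smul]
  rw [e1] at main
  rw [stdGaussian_eq_map_sum_basis, Measure.map_map (by fun_prop) (by fun_prop), ← he, ← e2]
  exact main

lemma map_smul_stdGaussian_conv (a b : ℝ) :
    ((stdGaussian (EuclideanSpace ℝ (Fin n))).map fun x => a • x) ∗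
        ((stdGaussian (EuclideanSpace ℝ (Fin n))).map fun x => b • x) =
      (stdGaussian (EuclideanSpace ℝ (Fin n))).map fun x => √(a ^ 2 + b ^ 2) • x := by
  have hp : ∀ c : ℝ, IsProbabilityMeasure
      ((stdGaussian (EuclideanSpace ℝ (Fin n))).map fun x => c • x) := fun c =>
    Measure.isProbabilityMeasure_map (by fun_prop)
  have := hp a
  have := hp b
  have := hp (√(a ^ 2 + b ^ 2))
  refine Measure.ext_of_charFun (funext fun t => ?_)
  rw [charFun_conv, charFun_map_smul, charFun_map_smul, charFun_map_smul, charFun_stdGaussian,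
    charFun_stdGaussian, charFun_stdGaussian, ← Complex.exp_add]
  congr 1
  simp only [norm_smul, Real.norm_eq_abs, mul_pow, Complex.ofReal_mul]
  norm_cast
  rw [sq_abs, sq_abs, sq_abs, Real.sq_sqrt (by positivity)]
  ring

/-- Variances of independent Gaussians add, so a partial sum over `s` is dominated at scale `c *
√s.card`. -/
lemma convexDominated_stdGaussian_sum {Ω ι : Type*} [MeasurableSpace Ω] {μ : Measure Ω}
    [IsProbabilityMeasure μ] [Fintype ι] {Z : ι → Ω → EuclideanSpace ℝ (Fin n)}
    (hZ : ∀ i, Measurable (Z i)) (hind : iIndepFun Z μ) {c : ℝ} (hc : 0 ≤ c)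
    (hdom : ∀ i, ConvexDominated (μ.map (Z i))
      ((stdGaussian (EuclideanSpace ℝ (Fin n))).map fun x => c • x)) :
    ConvexDominated (μ.map fun ω => ∑ i, Z i ω) ((stdGaussian (EuclideanSpace ℝ (Fin n))).map
      fun x => (c * √(Fintype.card ι)) • x) := by
  classical
  have hp : ∀ c : ℝ, IsProbabilityMeasure
      ((stdGaussian (EuclideanSpace ℝ (Fin n))).map fun x => c • x) := fun c =>
    Measure.isProbabilityMeasure_map (by fun_prop)
  have hp' := hp c
  have main := convexDominated_map_sum hZ hind
    (σ := fun _ => (stdGaussian (EuclideanSpace ℝ (Fin n))).map fun x => c • x)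
    (τ := fun s => (stdGaussian (EuclideanSpace ℝ (Fin n))).map fun x => (c * √(s.card : ℝ)) • x)
    hdom (by simp [Measure.map_const])
    (fun s i hi => by
      rw [map_smul_stdGaussian_conv, Finset.card_insert_of_notMem hi]
      have : √((c * √(s.card : ℝ)) ^ 2 + c ^ 2) = c * √((s.card + 1 : ℕ) : ℝ) := by
        rw [mul_pow, Real.sq_sqrt (by positivity)]
        conv_rhs => rw [← Real.sqrt_sq hc, ← Real.sqrt_mul (sq_nonneg c)]
        push_cast
        ring_nf
      rw [this]) Finset.univ
  have e : (∑ i, Z i) = fun ω => ∑ i, Z i ω := by ext1 ω; simp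
  rwa [e, Finset.card_univ] at main

end GaussianVectors

/-! ### Support functions of bounded sets: sublinear, convex and Lipschitz. -/

section SupportFunction

variable {E : Type*} [NormedAddCommGroup E] [InnerProductSpace ℝ E]

/-- The support function of a set. -/
noncomputable def supportFunction (T : Set E) (u : E) : ℝ := sSup ((fun z => ⟪u, z⟫) '' T)

variable {T : Set E} {R : ℝ}

lemma bddAbove_inner_image (hR : ∀ z ∈ T, ‖z‖ ≤ R) (u : E) :
    BddAbove ((fun z => ⟪u, z⟫) '' T) := by
  refine ⟨‖u‖ * R, ?_⟩
  rintro _ ⟨z, hz, rfl⟩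
  exact (real_inner_le_norm u z).trans (by gcongr; exact hR z hz)

lemma inner_le_supportFunction (hR : ∀ z ∈ T, ‖z‖ ≤ R) (u : E) {z : E} (hz : z ∈ T) :
    ⟪u, z⟫ ≤ supportFunction T u :=
  le_csSup (bddAbove_inner_image hR u) ⟨z, hz, rfl⟩

lemma supportFunction_le (hT : T.Nonempty) {u : E} {c : ℝ} (h : ∀ z ∈ T, ⟪u, z⟫ ≤ c) :
    supportFunction T u ≤ c :=
  csSup_le (hT.image _) (by rintro _ ⟨z, hz, rfl⟩; exact h z hz)

lemma supportFunction_add_le (hT : T.Nonempty) (hR : ∀ z ∈ T, ‖z‖ ≤ R) (u v : E) :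
    supportFunction T (u + v) ≤ supportFunction T u + supportFunction T v :=
  supportFunction_le hT fun z hz => by
    rw [inner_add_left]
    exact add_le_add (inner_le_supportFunction hR u hz) (inner_le_supportFunction hR v hz)

lemma supportFunction_le_norm (hT : T.Nonempty) (hR : ∀ z ∈ T, ‖z‖ ≤ R) (u : E) :
    supportFunction T u ≤ R * ‖u‖ :=
  supportFunction_le hT fun z hz => (real_inner_le_norm u z).trans (by
    rw [mul_comm]; gcongr; exact hR z hz)

lemma supportFunction_smul {c : ℝ} (hc : 0 ≤ c) (u : E) :
    supportFunction T (c • u) = c * supportFunction T u := by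
  have h : (fun z => ⟪c • u, z⟫) '' T = c • ((fun z => ⟪u, z⟫) '' T) := by
    ext t
    simp [Set.mem_smul_set, inner_smul_left]
  rw [supportFunction, h, Real.sSup_smul_of_nonneg hc]
  rfl

lemma convexOn_supportFunction (hT : T.Nonempty) (hR : ∀ z ∈ T, ‖z‖ ≤ R) :
    ConvexOn ℝ Set.univ (supportFunction T) := by
  refine ⟨convex_univ, fun u _ v _ a b ha hb _ => ?_⟩
  rw [smul_eq_mul, smul_eq_mul, ← supportFunction_smul ha, ← supportFunction_smul hb]
  exact supportFunction_add_le hT hR _ _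

lemma supportFunction_sub_le (hT : T.Nonempty) (hR : ∀ z ∈ T, ‖z‖ ≤ R) (u v : E) :
    supportFunction T u - supportFunction T v ≤ R * ‖u - v‖ := by
  have h1 := supportFunction_add_le hT hR (u - v) v
  rw [sub_add_cancel] at h1
  have h2 := supportFunction_le_norm hT hR (u - v)
  linarith

lemma continuous_supportFunction (hT : T.Nonempty) (hR : ∀ z ∈ T, ‖z‖ ≤ R) :
    Continuous (supportFunction T) := by
  obtain ⟨z, hz⟩ := hT
  have hR0 : 0 ≤ R := (norm_nonneg z).trans (hR z hz)
  refine (LipschitzWith.of_dist_le_mul (K := ⟨R, hR0⟩) fun u v => ?_).continuous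
  rw [Real.dist_eq, dist_eq_norm]
  refine abs_sub_le_iff.2 ⟨supportFunction_sub_le ⟨z, hz⟩ hR u v, ?_⟩
  rw [norm_sub_rev]
  exact supportFunction_sub_le ⟨z, hz⟩ hR v u

lemma abs_supportFunction_le (hT : T.Nonempty) (hR : ∀ z ∈ T, ‖z‖ ≤ R) (u : E) :
    |supportFunction T u| ≤ R * ‖u‖ := by
  have h0 : supportFunction T (0 : E) = 0 := by
    have := supportFunction_smul (T := T) le_rfl (0 : E)
    simpa using this
  have h1 := supportFunction_sub_le hT hR u 0
  have h2 := supportFunction_sub_le hT hR 0 u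
  rw [h0, sub_zero, sub_zero] at h1
  rw [h0, zero_sub, zero_sub, norm_neg] at h2
  exact abs_le.2 ⟨by linarith, h1⟩

end SupportFunction

/-! ### Jensen's inequality for lower Lebesgue integrals. -/

section Jensen

/-- Only `f` has to be integrable: if `Ψ ∘ f` is not, the right side is infinite. -/
lemma ofReal_map_integral_le_lintegral {Ω E : Type*} [MeasurableSpace Ω] {μ : Measure Ω}
    [IsProbabilityMeasure μ] [NormedAddCommGroup E] [NormedSpace ℝ E] [CompleteSpace E]
    {Ψ : E → ℝ} (hΨ : ConvexOn ℝ Set.univ Ψ) (hc : Continuous Ψ) (h0 : ∀ x, 0 ≤ Ψ x) {f : Ω → E}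
    (hf : Integrable f μ) :
    ENNReal.ofReal (Ψ (∫ ω, f ω ∂μ)) ≤ ∫⁻ ω, ENNReal.ofReal (Ψ (f ω)) ∂μ := by
  by_cases h : Integrable (fun ω => Ψ (f ω)) μ
  · rw [← ofReal_integral_eq_lintegral_ofReal h (Filter.Eventually.of_forall fun ω => h0 _)]
    exact ENNReal.ofReal_le_ofReal
      (hΨ.map_integral_le hc.continuousOn isClosed_univ (by simp) hf h)
  · have hm : AEStronglyMeasurable (fun ω => Ψ (f ω)) μ := hc.comp_aestronglyMeasurable hf.1
    have : ∫⁻ ω, ENNReal.ofReal (Ψ (f ω)) ∂μ = ∞ := by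
      by_contra hne
      refine h ⟨hm, ?_⟩
      rw [hasFiniteIntegral_iff_ofReal (Filter.Eventually.of_forall fun ω => h0 _)]
      exact lt_top_iff_ne_top.2 hne
    rw [this]
    exact le_top

end Jensen

/-! ### Gaussian concentration for support functions by discretised rotation. -/

section GaussianConcentration

open Filter Topology

variable {E : Type*} [NormedAddCommGroup E] [InnerProductSpace ℝ E] [FiniteDimensional ℝ E]
  [MeasurableSpace E] [BorelSpace E]

lemma lintegral_exp_inner_stdGaussian (z : E) (c : ℝ) :
    ∫⁻ u, ENNReal.ofReal (Real.exp (c * ⟪u, z⟫)) ∂(stdGaussian E) =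
      ENNReal.ofReal (Real.exp (c ^ 2 * ‖z‖ ^ 2 / 2)) := by
  set L : StrongDual ℝ E := innerSL ℝ z with hL
  have hLu : ∀ u, ⟪u, z⟫ = L u := fun u => by rw [hL, innerSL_apply_apply, real_inner_comm]
  have hlaw := IsGaussian.map_eq_gaussianReal (μ := stdGaussian E) L
  rw [integral_strongDual_stdGaussian, variance_dual_stdGaussian] at hlaw
  have hint : Integrable (fun t : ℝ => Real.exp (c * t))
      (gaussianReal 0 (‖L‖ ^ 2).toNNReal) := integrable_exp_mul_gaussianReal c
  simp only [hLu]
  rw [← lintegral_map (f := fun t : ℝ => ENNReal.ofReal (Real.exp (c * t))) (by fun_prop)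
    L.continuous.measurable, hlaw,
    ← ofReal_integral_eq_lintegral_ofReal hint (Eventually.of_forall fun t => (Real.exp_pos _).le)]
  have := congrFun (mgf_id_gaussianReal (μ := 0) (v := (‖L‖ ^ 2).toNNReal)) c
  simp only [mgf, id] at this
  rw [this, hL, innerSL_apply_norm, Real.coe_toNNReal _ (sq_nonneg _)]
  congr 2
  ring

/-- Fernique's theorem, after `c‖u‖ ≤ c² / (4C) + C‖u‖²` by completing the square. -/
lemma integrable_exp_mul_norm_stdGaussian (c : ℝ) :
    Integrable (fun u : E => Real.exp (c * ‖u‖)) (stdGaussian E) := by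
  obtain ⟨C, hC, hint⟩ := IsGaussian.exists_integrable_exp_sq (stdGaussian E)
  refine (hint.const_mul (Real.exp (c ^ 2 / (4 * C)))).mono' (by fun_prop)
    (Eventually.of_forall fun u => ?_)
  rw [Real.norm_eq_abs, abs_of_pos (Real.exp_pos _), ← Real.exp_add]
  refine Real.exp_le_exp.2 ?_
  have h : c ^ 2 / (4 * C) + C * ‖u‖ ^ 2 - c * ‖u‖ = (c - 2 * C * ‖u‖) ^ 2 / (4 * C) := by
    field_simp; ring
  have : 0 ≤ (c - 2 * C * ‖u‖) ^ 2 / (4 * C) := by positivity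
  linarith

/-- Shows that the second-order error of the discretised rotation disappears as the mesh tends to
zero. -/
lemma tendsto_integral_exp_div_mul_norm_stdGaussian {c : ℝ} (hc : 0 ≤ c) :
    Tendsto (fun N : ℕ => ∫ u : E, Real.exp (c / (N + 1 : ℕ) * ‖u‖) ∂(stdGaussian E)) atTop (𝓝 1) := by
  have h1 : (1 : ℝ) = ∫ _ : E, (1 : ℝ) ∂(stdGaussian E) := by simp
  rw [h1]
  refine tendsto_integral_of_dominated_convergence (fun u : E => Real.exp (c * ‖u‖))
    (fun N => by fun_prop) (integrable_exp_mul_norm_stdGaussian c) (fun N => ?_) ?_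
  · refine Eventually.of_forall fun u => ?_
    rw [Real.norm_eq_abs, abs_of_pos (Real.exp_pos _)]
    refine Real.exp_le_exp.2 (mul_le_mul_of_nonneg_right (div_le_self hc ?_) (norm_nonneg _))
    push_cast
    linarith [(Nat.cast_nonneg N : (0 : ℝ) ≤ N)]
  · refine Eventually.of_forall fun u => ?_
    have h2 : Tendsto (fun N : ℕ => c / (N + 1 : ℕ) * ‖u‖) atTop (𝓝 (0 * ‖u‖)) :=
      ((tendsto_const_div_atTop_nhds_zero_nat c).comp (tendsto_add_atTop_nat 1)).mul_const _
    rw [zero_mul] at h2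
    have h3 := (Real.continuous_exp.tendsto 0).comp h2
    rwa [Real.exp_zero] at h3

variable {T : Set E} {R : ℝ}

/-- A near-maximizer `z` for `u` is chosen before `w` is integrated. Testing the rotated point
against `z` bounds the increment by `(1 - cos δ) * ⟪u, z⟫ + sin δ * ⟪w, z⟫` up to `η`, and `⟪w, z⟫`
is Gaussian of variance at most `R ^ 2`. No gradient of the support function is needed. -/
lemma lintegral_exp_supportFunction_sub_le (hT : T.Nonempty) (hR : ∀ z ∈ T, ‖z‖ ≤ R) {b : ℝ}
    (hb : 0 ≤ b) (δ : ℝ) (u : E) :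
    ∫⁻ w, ENNReal.ofReal (Real.exp (b * (supportFunction T u -
        supportFunction T (Real.cos δ • u - Real.sin δ • w)))) ∂(stdGaussian E) ≤
      ENNReal.ofReal (Real.exp (b * (1 - Real.cos δ) * (R * ‖u‖) +
        b ^ 2 * Real.sin δ ^ 2 * R ^ 2 / 2)) := by
  have hR0 : 0 ≤ R := by
    obtain ⟨z, hz⟩ := hT
    exact (norm_nonneg z).trans (hR z hz)
  -- The supremum defining the support function need not be attained, hence the slack `η`, sent to
  -- zero at the end.
  have hη : ∀ η : ℝ, 0 < η → ∫⁻ w, ENNReal.ofReal (Real.exp (b * (supportFunction T u -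
        supportFunction T (Real.cos δ • u - Real.sin δ • w)))) ∂(stdGaussian E) ≤
      ENNReal.ofReal (Real.exp (b * η + (b * (1 - Real.cos δ) * (R * ‖u‖) +
        b ^ 2 * Real.sin δ ^ 2 * R ^ 2 / 2))) := by
    intro η hη
    obtain ⟨_, ⟨z, hz, rfl⟩, hlt⟩ := exists_lt_of_lt_csSup (hT.image fun z => ⟪u, z⟫)
      (sub_lt_self (supportFunction T u) hη)
    have hz1 : ⟪u, z⟫ ≤ R * ‖u‖ :=
      (inner_le_supportFunction hR u hz).trans (supportFunction_le_norm hT hR u)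
    have hpt : ∀ w, ENNReal.ofReal (Real.exp (b * (supportFunction T u -
        supportFunction T (Real.cos δ • u - Real.sin δ • w)))) ≤
        ENNReal.ofReal (Real.exp (b * η + b * (1 - Real.cos δ) * (R * ‖u‖))) *
          ENNReal.ofReal (Real.exp ((b * Real.sin δ) * ⟪w, z⟫)) := fun w => by
      rw [← ENNReal.ofReal_mul (Real.exp_pos _).le, ← Real.exp_add]
      refine ENNReal.ofReal_le_ofReal (Real.exp_le_exp.2 ?_)
      have h1 := inner_le_supportFunction hR (Real.cos δ • u - Real.sin δ • w) hz
      rw [inner_sub_left, inner_smul_left, inner_smul_left] at h1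
      simp only [conj_trivial] at h1
      have h2 : (1 - Real.cos δ) * ⟪u, z⟫ ≤ (1 - Real.cos δ) * (R * ‖u‖) :=
        mul_le_mul_of_nonneg_left hz1 (sub_nonneg.2 (Real.cos_le_one δ))
      have h3 : supportFunction T u - supportFunction T (Real.cos δ • u - Real.sin δ • w) ≤
          η + (1 - Real.cos δ) * (R * ‖u‖) + Real.sin δ * ⟪w, z⟫ := by
        simp only at hlt
        nlinarith
      calc _ ≤ b * (η + (1 - Real.cos δ) * (R * ‖u‖) + Real.sin δ * ⟪w, z⟫) :=
            mul_le_mul_of_nonneg_left h3 hb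
        _ = _ := by ring
    refine (lintegral_mono hpt).trans ?_
    rw [lintegral_const_mul' _ _ ENNReal.ofReal_ne_top, lintegral_exp_inner_stdGaussian,
      ← ENNReal.ofReal_mul (Real.exp_pos _).le, ← Real.exp_add]
    refine ENNReal.ofReal_le_ofReal (Real.exp_le_exp.2 ?_)
    have h4 : ‖z‖ ^ 2 ≤ R ^ 2 := pow_le_pow_left₀ (norm_nonneg _) (hR z hz) 2
    have h5 := mul_le_mul_of_nonneg_left h4 (sq_nonneg (b * Real.sin δ))
    linarith [mul_pow b (Real.sin δ) 2, mul_pow b (Real.sin δ) 2 ▸ h5]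
  have hlim : Tendsto (fun η : ℝ => ENNReal.ofReal (Real.exp (b * η +
      (b * (1 - Real.cos δ) * (R * ‖u‖) + b ^ 2 * Real.sin δ ^ 2 * R ^ 2 / 2)))) (𝓝[>] 0)
      (𝓝 (ENNReal.ofReal (Real.exp (b * (1 - Real.cos δ) * (R * ‖u‖) +
        b ^ 2 * Real.sin δ ^ 2 * R ^ 2 / 2)))) := by
    refine ENNReal.tendsto_ofReal (tendsto_nhdsWithin_of_tendsto_nhds ?_)
    have : Continuous fun η : ℝ => Real.exp (b * η +
      (b * (1 - Real.cos δ) * (R * ‖u‖) + b ^ 2 * Real.sin δ ^ 2 * R ^ 2 / 2)) := by fun_prop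
    simpa using this.tendsto 0
  exact ge_of_tendsto hlim (eventually_nhdsWithin_of_forall hη)

/-- The pair at angle `α` is the pair at angle `α + δ` turned back by `δ`. By rotation invariance
the latter is again a pair of independent standard Gaussians, so the fixed-`u` bound applies after
conditioning. -/
lemma lintegral_exp_supportFunction_rotation_step_le (hT : T.Nonempty) (hR : ∀ z ∈ T, ‖z‖ ≤ R)
    {b : ℝ} (hb : 0 ≤ b) (δ α : ℝ) :
    ∫⁻ p, ENNReal.ofReal (Real.exp (b *
        (supportFunction T (ContinuousLinearMap.rotation (α + δ) p).1 -
          supportFunction T (ContinuousLinearMap.rotation α p).1)))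
        ∂((stdGaussian E).prod (stdGaussian E)) ≤
      ∫⁻ u, ENNReal.ofReal (Real.exp (b * (1 - Real.cos δ) * (R * ‖u‖) +
        b ^ 2 * Real.sin δ ^ 2 * R ^ 2 / 2)) ∂(stdGaussian E) := by
  have hFc := continuous_supportFunction hT hR
  have hrot := IsGaussian.map_rotation_eq_self (μ := stdGaussian E)
    (by simp) (α + δ)
  have hfst : ∀ p : E × E, (ContinuousLinearMap.rotation α p).1 =
      Real.cos δ • (ContinuousLinearMap.rotation (α + δ) p).1 -
        Real.sin δ • (ContinuousLinearMap.rotation (α + δ) p).2 := fun p => by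
    simp only [ContinuousLinearMap.rotation_apply]
    have h1 : Real.cos α = Real.cos δ * Real.cos (α + δ) + Real.sin δ * Real.sin (α + δ) := by
      rw [show α = α + δ - δ by ring, Real.cos_sub]; ring_nf
    have h2 : Real.sin α = Real.cos δ * Real.sin (α + δ) - Real.sin δ * Real.cos (α + δ) := by
      rw [show α = α + δ - δ by ring, Real.sin_sub]; ring_nf
    rw [h1, h2]
    module
  set G : E × E → ℝ≥0∞ := fun q => ENNReal.ofReal (Real.exp (b * (supportFunction T q.1 -
    supportFunction T (Real.cos δ • q.1 - Real.sin δ • q.2)))) with hG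
  have hGm : Measurable G := by
    refine Measurable.ennreal_ofReal (Continuous.measurable ?_)
    fun_prop
  calc _ = ∫⁻ p, G (ContinuousLinearMap.rotation (α + δ) p)
        ∂((stdGaussian E).prod (stdGaussian E)) := by
        refine lintegral_congr fun p => ?_
        simp only [hG, hfst]
    _ = ∫⁻ q, G q ∂((stdGaussian E).prod (stdGaussian E)) := by
        rw [← lintegral_map hGm (ContinuousLinearMap.continuous _).measurable, hrot]
    _ = ∫⁻ u, ∫⁻ w, G (u, w) ∂(stdGaussian E) ∂(stdGaussian E) := lintegral_prod _ hGm.aemeasurable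
    _ ≤ _ := lintegral_mono fun u => lintegral_exp_supportFunction_sub_le hT hR hb δ u

/-- A quarter turn carries `p.1` to `p.2`. Cut into `M = N + 1` steps of angle `δ = π / (2 * M)`,
each step is amplified to `S * M` by Jensen but contributes only `(S * M) ^ 2 * δ ^ 2 * R ^ 2 / 2 =
π ^ 2 * S ^ 2 * R ^ 2 / 8`, whatever the mesh. -/
lemma lintegral_exp_supportFunction_prod_le (hT : T.Nonempty) (hR : ∀ z ∈ T, ‖z‖ ≤ R) {S : ℝ}
    (hS : 0 ≤ S) :
    ∫⁻ p, ENNReal.ofReal (Real.exp (S * (supportFunction T p.2 - supportFunction T p.1)))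
        ∂((stdGaussian E).prod (stdGaussian E)) ≤
      ENNReal.ofReal (Real.exp (Real.pi ^ 2 / 8 * S ^ 2 * R ^ 2)) := by
  have hR0 : 0 ≤ R := by
    obtain ⟨z, hz⟩ := hT
    exact (norm_nonneg z).trans (hR z hz)
  have hFc := continuous_supportFunction hT hR
  set c := S * Real.pi ^ 2 / 8 * R with hc
  have hc0 : 0 ≤ c := by positivity
  have hN : ∀ N : ℕ, ∫⁻ p, ENNReal.ofReal (Real.exp (S * (supportFunction T p.2 -
      supportFunction T p.1))) ∂((stdGaussian E).prod (stdGaussian E)) ≤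
      ENNReal.ofReal (Real.exp (Real.pi ^ 2 / 8 * S ^ 2 * R ^ 2) *
        ∫ u : E, Real.exp (c / (N + 1 : ℕ) * ‖u‖) ∂(stdGaussian E)) := by
    intro N
    set M : ℝ := ((N + 1 : ℕ) : ℝ) with hM
    have hM0 : 0 < M := by positivity
    set δ : ℝ := Real.pi / (2 * M) with hδ
    have hδ0 : 0 ≤ δ := by positivity
    set D : ℕ → E × E → ℝ := fun k p =>
      supportFunction T (ContinuousLinearMap.rotation (k * δ + δ) p).1 -
        supportFunction T (ContinuousLinearMap.rotation (k * δ) p).1 with hD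
    have htel : ∀ p : E × E, supportFunction T p.2 - supportFunction T p.1 =
        ∑ k ∈ Finset.range (N + 1), D k p := fun p => by
      have h1 := Finset.sum_range_sub
        (fun k : ℕ => supportFunction T (ContinuousLinearMap.rotation (k * δ) p).1) (N + 1)
      have h2 : ((N + 1 : ℕ) : ℝ) * δ = Real.pi / 2 := by rw [← hM, hδ]; field_simp
      simp only [h2, Nat.cast_zero, zero_mul, ContinuousLinearMap.rotation_apply, Real.cos_zero,
        Real.sin_zero, Real.cos_pi_div_two, Real.sin_pi_div_two, one_smul, zero_smul, add_zero,
        zero_add] at h1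
      rw [← h1]
      refine Finset.sum_congr rfl fun k _ => ?_
      simp only [hD, ContinuousLinearMap.rotation_apply]
      push_cast
      simp only [add_mul, one_mul]
    -- The increments are not independent; convexity of `exp` replaces the exponential of their sum
    -- by an average of exponentials of single increments.
    have hjen : ∀ p, Real.exp (S * (supportFunction T p.2 - supportFunction T p.1)) ≤
        ∑ k ∈ Finset.range (N + 1), M⁻¹ * Real.exp (S * M * D k p) := fun p => by
      have h1 := convexOn_exp.map_sum_le (t := Finset.range (N + 1)) (w := fun _ => M⁻¹)
        (p := fun k => S * M * D k p) (fun _ _ => by positivity)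
        (by simp [hM]; field_simp) (fun _ _ => Set.mem_univ _)
      simp only [smul_eq_mul] at h1
      refine le_trans (le_of_eq ?_) h1
      rw [htel, Finset.mul_sum]
      congr 1
      refine Finset.sum_congr rfl fun k _ => ?_
      field_simp
    have hDm : ∀ k, Measurable (D k) := fun k => by
      refine Continuous.measurable ?_
      fun_prop
    have hstep : ∀ k, ∫⁻ p, ENNReal.ofReal (Real.exp (S * M * D k p))
        ∂((stdGaussian E).prod (stdGaussian E)) ≤
        ENNReal.ofReal (Real.exp (Real.pi ^ 2 / 8 * S ^ 2 * R ^ 2) *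
          ∫ u : E, Real.exp (c / M * ‖u‖) ∂(stdGaussian E)) := fun k => by
      refine (lintegral_exp_supportFunction_rotation_step_le hT hR (by positivity) δ
        (k * δ)).trans ?_
      rw [← integral_const_mul, ofReal_integral_eq_lintegral_ofReal
        ((integrable_exp_mul_norm_stdGaussian _).const_mul _)
        (Eventually.of_forall fun u => by positivity)]
      refine lintegral_mono fun u => ENNReal.ofReal_le_ofReal ?_
      rw [← Real.exp_add]
      refine Real.exp_le_exp.2 ?_
      have h1 : 1 - Real.cos δ ≤ δ ^ 2 / 2 := by
        have := Real.one_sub_sq_div_two_le_cos (x := δ)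
        linarith
      have h2 : Real.sin δ ^ 2 ≤ δ ^ 2 := by
        rw [sq_le_sq]; exact Real.abs_sin_le_abs
      have h3 : S * M * (1 - Real.cos δ) * (R * ‖u‖) ≤ S * M * (δ ^ 2 / 2) * (R * ‖u‖) := by
        gcongr
      have h4 : (S * M) ^ 2 * Real.sin δ ^ 2 * R ^ 2 / 2 ≤ (S * M) ^ 2 * δ ^ 2 * R ^ 2 / 2 := by
        gcongr
      have h5 : S * M * (δ ^ 2 / 2) * (R * ‖u‖) = c / M * ‖u‖ := by
        rw [hδ, hc]; field_simp; ring
      have h6 : (S * M) ^ 2 * δ ^ 2 * R ^ 2 / 2 = Real.pi ^ 2 / 8 * S ^ 2 * R ^ 2 := by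
        rw [hδ]; field_simp; ring
      linarith
    calc _ ≤ ∫⁻ p, ∑ k ∈ Finset.range (N + 1), ENNReal.ofReal M⁻¹ *
          ENNReal.ofReal (Real.exp (S * M * D k p)) ∂((stdGaussian E).prod (stdGaussian E)) := by
          refine lintegral_mono fun p => ?_
          simp only [← ENNReal.ofReal_mul (inv_nonneg.2 hM0.le)]
          rw [← ENNReal.ofReal_sum_of_nonneg fun k _ => by positivity]
          exact ENNReal.ofReal_le_ofReal (hjen p)
      _ = ∑ k ∈ Finset.range (N + 1), ENNReal.ofReal M⁻¹ *
          ∫⁻ p, ENNReal.ofReal (Real.exp (S * M * D k p))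
            ∂((stdGaussian E).prod (stdGaussian E)) := by
          rw [lintegral_finsetSum _ fun k _ => by have := hDm k; fun_prop]
          refine Finset.sum_congr rfl fun k _ => ?_
          rw [lintegral_const_mul' _ _ ENNReal.ofReal_ne_top]
      _ ≤ ∑ _k ∈ Finset.range (N + 1), ENNReal.ofReal M⁻¹ *
          ENNReal.ofReal (Real.exp (Real.pi ^ 2 / 8 * S ^ 2 * R ^ 2) *
            ∫ u : E, Real.exp (c / M * ‖u‖) ∂(stdGaussian E)) :=
          Finset.sum_le_sum fun k _ => mul_le_mul_right (hstep k) _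
      _ = _ := by
          rw [Finset.sum_const, Finset.card_range, nsmul_eq_mul, ← mul_assoc]
          have : ((N + 1 : ℕ) : ℝ≥0∞) * ENNReal.ofReal M⁻¹ = 1 := by
            rw [← ENNReal.ofReal_natCast, ← ENNReal.ofReal_mul (by positivity), ← hM,
              mul_inv_cancel₀ hM0.ne', ENNReal.ofReal_one]
          rw [this, one_mul]
  have hlim := ENNReal.tendsto_ofReal
    ((tendsto_integral_exp_div_mul_norm_stdGaussian (E := E) hc0).const_mul
      (Real.exp (Real.pi ^ 2 / 8 * S ^ 2 * R ^ 2)))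
  rw [mul_one] at hlim
  exact ge_of_tendsto hlim (Eventually.of_forall hN)

lemma integrable_supportFunction_stdGaussian (hT : T.Nonempty) (hR : ∀ z ∈ T, ‖z‖ ≤ R) :
    Integrable (supportFunction T) (stdGaussian E) := by
  have hFc := continuous_supportFunction hT hR
  refine ((IsGaussian.integrable_id (μ := stdGaussian E)).norm.const_mul R).mono'
    hFc.aestronglyMeasurable (Eventually.of_forall fun u => ?_)
  exact abs_supportFunction_le hT hR u

/-- Gaussian concentration of support functions, in exponential form. -/
theorem lintegral_exp_supportFunction_stdGaussian_le (hT : T.Nonempty) (hR : ∀ z ∈ T, ‖z‖ ≤ R)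
    {S : ℝ} (hS : 0 ≤ S) :
    ∫⁻ u, ENNReal.ofReal (Real.exp (S * supportFunction T u)) ∂(stdGaussian E) ≤
      ENNReal.ofReal (Real.exp (S * ∫ u, supportFunction T u ∂(stdGaussian E) +
        Real.pi ^ 2 / 8 * S ^ 2 * R ^ 2)) := by
  have hFc := continuous_supportFunction hT hR
  set w := ∫ u, supportFunction T u ∂(stdGaussian E) with hw
  have hconv : ConvexOn ℝ Set.univ fun t : ℝ => Real.exp (-S * t) :=
    convexOn_comp_continuousLinearMap convexOn_exp ((-S) • ContinuousLinearMap.id ℝ ℝ)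
  -- Jensen bounds `exp (-S * w)` by the exponential moment in `p.1`, so the two-sample bound
  -- becomes a one-sample bound around the mean `w`.
  have hjen := ofReal_map_integral_le_lintegral hconv (by fun_prop) (fun x => (Real.exp_pos _).le)
    (integrable_supportFunction_stdGaussian hT hR)
  rw [← hw] at hjen
  have hprod : (∫⁻ u, ENNReal.ofReal (Real.exp (-S * supportFunction T u)) ∂(stdGaussian E)) *
      ∫⁻ u, ENNReal.ofReal (Real.exp (S * supportFunction T u)) ∂(stdGaussian E) =
      ∫⁻ p, ENNReal.ofReal (Real.exp (S * (supportFunction T p.2 - supportFunction T p.1)))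
        ∂((stdGaussian E).prod (stdGaussian E)) := by
    rw [← lintegral_prod_mul (by fun_prop) (by fun_prop)]
    refine lintegral_congr fun p => ?_
    rw [← ENNReal.ofReal_mul (Real.exp_pos _).le, ← Real.exp_add]
    congr 2
    ring
  have hle := (mul_le_mul_left hjen _).trans
    (hprod.le.trans (lintegral_exp_supportFunction_prod_le hT hR hS))
  calc ∫⁻ u, ENNReal.ofReal (Real.exp (S * supportFunction T u)) ∂(stdGaussian E)
      = ENNReal.ofReal (Real.exp (S * w)) * (ENNReal.ofReal (Real.exp (-S * w)) *
        ∫⁻ u, ENNReal.ofReal (Real.exp (S * supportFunction T u)) ∂(stdGaussian E)) := by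
        rw [← mul_assoc, ← ENNReal.ofReal_mul (Real.exp_pos _).le, ← Real.exp_add]
        simp
    _ ≤ ENNReal.ofReal (Real.exp (S * w)) *
        ENNReal.ofReal (Real.exp (Real.pi ^ 2 / 8 * S ^ 2 * R ^ 2)) := by gcongr
    _ = _ := by rw [← ENNReal.ofReal_mul (Real.exp_pos _).le, ← Real.exp_add]

end GaussianConcentration

/-! ### Independence and conditional means in the generalized linear model. -/

section Model

lemma real_inter_eq_setIntegral_of_condExp {Ω : Type*} {𝓖 mΩ : MeasurableSpace Ω} {μ : Measure Ω}
    [IsProbabilityMeasure μ] (h𝓖 : 𝓖 ≤ mΩ) {G Y : Set Ω} (hG : MeasurableSet[𝓖] G)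
    (hY : MeasurableSet[mΩ] Y)
    {q : Ω → ℝ} (hq : μ⟦Y | 𝓖⟧ =ᵐ[μ] q) : μ.real (G ∩ Y) = ∫ ω in G, q ω ∂μ := by
  have h1 := setIntegral_condExp (μ := μ) h𝓖
    ((integrable_const (1 : ℝ)).indicator hY) hG
  rw [setIntegral_indicator hY] at h1
  simp only [integral_const, smul_eq_mul, mul_one, measureReal_restrict_apply_univ] at h1
  rw [← h1]
  exact integral_congr_ae (ae_restrict_of_ae hq)

variable {Ω : Type*} {m n : ℕ} {θ : ℝ → ℝ} {x : EuclideanSpace ℝ (Fin n)}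
  {A : Fin m → Ω → EuclideanSpace ℝ (Fin n)} {y : Fin m → Ω → ℝ}

/-- The conditional probability of `y i ∈ B` as a function of the measurement vector. -/
noncomputable def labelKernel (θ : ℝ → ℝ) (x : EuclideanSpace ℝ (Fin n)) (B : Set ℝ)
    (v : EuclideanSpace ℝ (Fin n)) : ℝ :=
  (B.indicator 1 1 + B.indicator 1 (-1)) / 2 + (B.indicator 1 1 - B.indicator 1 (-1)) / 2 * θ ⟪v, x⟫

lemma measurable_labelKernel (hθ : Continuous θ) (B : Set ℝ) : Measurable (labelKernel θ x B) := by
  unfold labelKernel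
  fun_prop

lemma measurable_comap_pi (A : Fin m → Ω → EuclideanSpace ℝ (Fin n)) (i : Fin m) :
    Measurable[MeasurableSpace.comap (fun ω k => A k ω) inferInstance] (A i) :=
  (measurable_pi_apply i).comp (comap_measurable fun ω k => A k ω)

variable [MeasurableSpace Ω] {μ : Measure Ω}

lemma comap_pi_le (hA : ∀ i, Measurable (A i)) :
    MeasurableSpace.comap (fun ω k => A k ω) inferInstance ≤ ‹MeasurableSpace Ω› :=
  (measurable_pi_lambda _ hA).comap_le

lemma GeneralizedLinearModel.abs_eq_one (h : GeneralizedLinearModel μ θ x A y) (i : Fin m) (ω : Ω) :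
    |y i ω| = 1 := by
  rcases h.sign_valued i ω with h | h <;> simp [h]

variable [IsProbabilityMeasure μ]

lemma GeneralizedLinearModel.integrable (h : GeneralizedLinearModel μ θ x A y) (i : Fin m) :
    Integrable (y i) μ :=
  Integrable.of_bound (h.measurable i).aestronglyMeasurable 1
    (Filter.Eventually.of_forall fun ω => (h.abs_eq_one i ω).le)

/-- On `{-1, 1}` every indicator is an affine function of `y`, so the conditional mean determines
the conditional law. -/
lemma GeneralizedLinearModel.condExp_preimage (h : GeneralizedLinearModel μ θ x A y)
    (hA : ∀ i, Measurable (A i)) (i : Fin m) (B : Set ℝ) :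
    μ⟦y i ⁻¹' B | MeasurableSpace.comap (fun ω k => A k ω) inferInstance⟧
      =ᵐ[μ] fun ω => labelKernel θ x B (A i ω) := by
  have hle := comap_pi_le hA
  set α : ℝ := (B.indicator 1 1 + B.indicator 1 (-1)) / 2 with hα
  set β : ℝ := (B.indicator 1 1 - B.indicator 1 (-1)) / 2 with hβ
  have h1 : (y i ⁻¹' B).indicator (fun _ => (1 : ℝ)) = (fun _ => α) + β • y i := by
    ext ω
    have h2 : (y i ⁻¹' B).indicator (fun _ => (1 : ℝ)) ω = B.indicator 1 (y i ω) := by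
      by_cases hω : y i ω ∈ B
      · rw [Set.indicator_of_mem (Set.mem_preimage.2 hω), Set.indicator_of_mem hω, Pi.one_apply]
      · rw [Set.indicator_of_notMem (mt Set.mem_preimage.1 hω), Set.indicator_of_notMem hω]
    rw [h2, Pi.add_apply, Pi.smul_apply, smul_eq_mul, hα, hβ]
    rcases h.sign_valued i ω with h | h <;> rw [h] <;> ring
  rw [h1]
  refine (condExp_add (integrable_const α) ((h.integrable i).smul β) _).trans ?_
  rw [condExp_const hle]
  filter_upwards [condExp_smul (μ := μ) β (y i)
    (MeasurableSpace.comap (fun ω k => A k ω) inferInstance), h.condMean i] with ω h3 h4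
  rw [Pi.add_apply, h3, Pi.smul_apply, h4]
  rfl

lemma GeneralizedLinearModel.real_inter_eq (h : GeneralizedLinearModel μ θ x A y)
    (hA : ∀ i, Measurable (A i)) (i : Fin m) {C : Set (EuclideanSpace ℝ (Fin n))}
    (hC : MeasurableSet C) {B : Set ℝ} (hB : MeasurableSet B) :
    μ.real (A i ⁻¹' C ∩ y i ⁻¹' B) = ∫ ω, C.indicator (labelKernel θ x B) (A i ω) ∂μ := by
  rw [real_inter_eq_setIntegral_of_condExp (comap_pi_le hA) (measurable_comap_pi A i hC)
    (h.measurable i hB) (h.condExp_preimage hA i B), ← integral_indicator (hA i hC)]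
  rfl

/-- Given all the vectors, the probability of the label event is a product of functions of the
individual `A i`; independence of the `A i` then factors the expectation. -/
lemma GeneralizedLinearModel.real_iInter_eq (h : GeneralizedLinearModel μ θ x A y)
    (hA : ∀ i, Measurable (A i)) (hind : iIndepFun A μ) (hθ : Continuous θ)
    {C : Fin m → Set (EuclideanSpace ℝ (Fin n))} (hC : ∀ i, MeasurableSet (C i))
    {B : Fin m → Set ℝ} (hB : ∀ i, MeasurableSet (B i)) :
    μ.real (⋂ i, A i ⁻¹' C i ∩ y i ⁻¹' B i) = ∏ i, μ.real (A i ⁻¹' C i ∩ y i ⁻¹' B i) := by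
  have hq : μ⟦⋂ i, y i ⁻¹' B i | MeasurableSpace.comap (fun ω k => A k ω) inferInstance⟧
      =ᵐ[μ] fun ω => ∏ i, labelKernel θ x (B i) (A i ω) := by
    filter_upwards [h.condIndep B hB, ae_all_iff.2 fun i => h.condExp_preimage hA i (B i)]
      with ω h1 h2
    rw [h1]
    exact Finset.prod_congr rfl fun i _ => h2 i
  have hG : MeasurableSet[MeasurableSpace.comap (fun ω k => A k ω) inferInstance]
      (⋂ i, A i ⁻¹' C i) :=
    MeasurableSet.iInter fun i => measurable_comap_pi A i (hC i)
  have hφ : ∀ i, Measurable ((C i).indicator (labelKernel θ x (B i))) := fun i =>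
    (measurable_labelKernel hθ (B i)).indicator (hC i)
  have hprod := (hind.comp (fun i => (C i).indicator (labelKernel θ x (B i)))
    hφ).integral_fun_prod_eq_prod_integral
      fun i => ((hφ i).comp (hA i)).aestronglyMeasurable
  rw [Set.iInter_inter_distrib, real_inter_eq_setIntegral_of_condExp (comap_pi_le hA) hG
    (MeasurableSet.iInter fun i => h.measurable i (hB i)) hq,
    ← integral_indicator (MeasurableSet.iInter fun i => hA i (hC i))]
  simp only [Function.comp_apply] at hprod
  rw [Finset.prod_congr rfl fun i _ => h.real_inter_eq hA i (hC i) (hB i), ← hprod]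
  congr 1
  ext ω
  by_cases hω : ω ∈ ⋂ i, A i ⁻¹' C i
  · rw [Set.indicator_of_mem hω]
    refine Finset.prod_congr rfl fun i _ => ?_
    have hi : A i ω ∈ C i := Set.mem_iInter.1 hω i
    rw [Set.indicator_of_mem hi]
  · rw [Set.indicator_of_notMem hω]
    obtain ⟨i, hi⟩ := not_forall.1 (mt Set.mem_iInter.2 hω)
    have hi' : A i ω ∉ C i := hi
    exact (Finset.prod_eq_zero (Finset.mem_univ i) (Set.indicator_of_notMem hi' _)).symm

lemma GeneralizedLinearModel.iIndepFun_prod (h : GeneralizedLinearModel μ θ x A y)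
    (hA : ∀ i, Measurable (A i)) (hind : iIndepFun A μ) (hθ : Continuous θ) :
    iIndepFun (fun i ω => (A i ω, y i ω)) μ := by
  have hm : ∀ i, Measurable fun ω => (A i ω, y i ω) := fun i => (hA i).prodMk (h.measurable i)
  have hp : ∀ i, IsProbabilityMeasure (μ.map fun ω => (A i ω, y i ω)) := fun i =>
    Measure.isProbabilityMeasure_map (hm i).aemeasurable
  refine (iIndepFun_iff_map_fun_eq_pi_map fun i => (hm i).aemeasurable).2 (Eq.symm ?_)
  refine Measure.pi_eq_generateFrom (C := fun _ => Set.image2 (fun s t => s ×ˢ t)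
    {s : Set (EuclideanSpace ℝ (Fin n)) | MeasurableSet s} {t : Set ℝ | MeasurableSet t})
    (fun _ => generateFrom_prod) (fun _ => isPiSystem_prod)
    (fun i => ⟨fun _ => Set.univ, fun _ => ⟨Set.univ, by simp, Set.univ,
      by simp, Set.univ_prod_univ⟩, fun _ => measure_lt_top _ _,
      Set.iUnion_const _⟩) fun s hs => ?_
  choose C hC B hB hCB using hs
  replace hC : ∀ i, MeasurableSet (C i) := hC
  replace hB : ∀ i, MeasurableSet (B i) := hB
  have hs' : ∀ i, MeasurableSet (s i) := fun i => hCB i ▸ (hC i).prod (hB i)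
  have hpre : ∀ i, (fun ω => (A i ω, y i ω)) ⁻¹' s i = A i ⁻¹' C i ∩ y i ⁻¹' B i := fun i => by
    rw [← hCB i]; rfl
  rw [Measure.map_apply (measurable_pi_lambda _ hm) (MeasurableSet.univ_pi hs')]
  have hset : (fun ω i => (A i ω, y i ω)) ⁻¹' Set.univ.pi s
      = ⋂ i, A i ⁻¹' C i ∩ y i ⁻¹' B i := by
    ext ω
    simp only [Set.mem_preimage, Set.mem_univ_pi, Set.mem_iInter, ← hpre]
  rw [hset, Finset.prod_congr rfl fun i _ => by
    rw [Measure.map_apply (hm i) (hs' i), hpre i]]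
  have := h.real_iInter_eq hA hind hθ hC hB
  simp only [measureReal_def] at this
  rw [← ENNReal.toReal_prod] at this
  exact (ENNReal.toReal_eq_toReal_iff' (measure_ne_top _ _)
    (ENNReal.prod_ne_top fun i _ => measure_ne_top _ _)).1 this

lemma GeneralizedLinearModel.iIndepFun_smul (h : GeneralizedLinearModel μ θ x A y)
    (hA : ∀ i, Measurable (A i)) (hind : iIndepFun A μ) (hθ : Continuous θ) :
    iIndepFun (fun i ω => y i ω • A i ω) μ :=
  (h.iIndepFun_prod hA hind hθ).comp (fun _ p => p.2 • p.1) fun _ => by fun_prop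

lemma GeneralizedLinearModel.integral_mul_eq (h : GeneralizedLinearModel μ θ x A y)
    (hA : ∀ i, Measurable (A i)) (i : Fin m) {g : EuclideanSpace ℝ (Fin n) → ℝ}
    (hg : Measurable g) (hgi : Integrable (fun ω => g (A i ω)) μ) :
    ∫ ω, y i ω * g (A i ω) ∂μ = ∫ ω, θ ⟪A i ω, x⟫ * g (A i ω) ∂μ := by
  have hle := comap_pi_le hA
  have hint : Integrable (y i * fun ω => g (A i ω)) μ :=
    hgi.bdd_mul (h.measurable i).aestronglyMeasurable (c := 1)
      (Filter.Eventually.of_forall fun ω => (h.abs_eq_one i ω).le)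
  have h1 := condExp_mul_of_stronglyMeasurable_right (μ := μ)
    (hg.comp (measurable_comap_pi A i)).stronglyMeasurable hint (h.integrable i)
  rw [show ∫ ω, y i ω * g (A i ω) ∂μ = ∫ ω, (y i * fun ω => g (A i ω)) ω ∂μ from rfl,
    ← integral_condExp hle]
  refine integral_congr_ae ?_
  filter_upwards [h1, h.condMean i] with ω h2 h3
  refine h2.trans ?_
  rw [Pi.mul_apply, h3]
  rfl

end Model

/-! ### Convex domination of randomly signed, recentred vectors. -/

section SignedVectors

variable {E : Type*} [NormedAddCommGroup E] [NormedSpace ℝ E] [CompleteSpace E]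
  [MeasurableSpace E] [BorelSpace E] [SecondCountableTopology E]
  {Ω : Type*} [MeasurableSpace Ω] {μ : Measure Ω} [IsProbabilityMeasure μ]

/-- Centred random sign changes of a vector are dominated by twice the vector, provided the vector
is dominated by a symmetric law. -/
lemma convexDominated_sign_smul_sub_integral {A : Ω → E} {y : Ω → ℝ} (hA : Measurable A)
    (hy : Measurable y) (hsign : ∀ ω, y ω = -1 ∨ y ω = 1)
    (hint : Integrable (fun ω => y ω • A ω) μ) {ρ : Measure E} (hρ : ρ.map (fun v => -v) = ρ)
    (hdom : ConvexDominated (μ.map A) ρ) :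
    ConvexDominated (μ.map fun ω => y ω • A ω - ∫ ω', y ω' • A ω' ∂μ)
      (ρ.map fun v => (2 : ℝ) • v) := by
  intro Ψ hΨ hc h0
  set v := ∫ ω', y ω' • A ω' ∂μ with hv
  have hm : Measurable fun u => ENNReal.ofReal (Ψ u) := hc.measurable.ennreal_ofReal
  rw [lintegral_map hm (by fun_prop), lintegral_map hm (by fun_prop)]
  set J := ∫⁻ u, ENNReal.ofReal (Ψ ((2 : ℝ) • u)) ∂ρ with hJ
  have hconv2 : ∀ c : ℝ, ConvexOn ℝ Set.univ fun u => Ψ (c • u) := fun c =>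
    convexOn_comp_continuousLinearMap hΨ (c • ContinuousLinearMap.id ℝ E)
  have hplus : ∫⁻ ω, ENNReal.ofReal (Ψ ((2 : ℝ) • A ω)) ∂μ ≤ J := by
    have := hdom (fun u => Ψ ((2 : ℝ) • u)) (hconv2 2) (by fun_prop) fun u => h0 _
    rwa [lintegral_map (by fun_prop) hA] at this
  have hminus : ∫⁻ ω, ENNReal.ofReal (Ψ ((-2 : ℝ) • A ω)) ∂μ ≤ J := by
    have := hdom (fun u => Ψ ((-2 : ℝ) • u)) (hconv2 (-2)) (by fun_prop) fun u => h0 _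
    rw [lintegral_map (by fun_prop) hA] at this
    refine this.trans (le_of_eq ?_)
    rw [hJ]
    conv_rhs => rw [← hρ]
    rw [lintegral_map (by fun_prop) (by fun_prop)]
    simp
  have hjen := ofReal_map_integral_le_lintegral (hconv2 (-2)) (by fun_prop) (fun u => h0 _) hint
  rw [← hv] at hjen
  -- The centred vector is the midpoint of `2 • (y ω • A ω)` and `-2 • v`; Jensen then compares the
  -- second term with the integral of `Ψ (-2 • (y • A))`.
  have hpt : ∀ ω, ENNReal.ofReal (Ψ (y ω • A ω - v)) ≤
      ENNReal.ofReal (1 / 2) * (ENNReal.ofReal (Ψ ((2 : ℝ) • (y ω • A ω))) +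
        ENNReal.ofReal (Ψ ((-2 : ℝ) • v))) := fun ω => by
    rw [← ENNReal.ofReal_add (h0 _) (h0 _), ← ENNReal.ofReal_mul (by norm_num)]
    refine ENNReal.ofReal_le_ofReal ?_
    have h1 := hΨ.2 (Set.mem_univ ((2 : ℝ) • (y ω • A ω))) (Set.mem_univ ((-2 : ℝ) • v))
      (by norm_num : (0 : ℝ) ≤ 1 / 2) (by norm_num : (0 : ℝ) ≤ 1 / 2) (by norm_num)
    have h2 : (1 / 2 : ℝ) • ((2 : ℝ) • (y ω • A ω)) + (1 / 2 : ℝ) • ((-2 : ℝ) • v)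
        = y ω • A ω - v := by module
    rw [h2, smul_eq_mul, smul_eq_mul] at h1
    linarith
  -- The sign may depend on `A`, so `y • A` by itself is not controlled. But `±(y ω • A ω)` is the
  -- same pair as `±A ω` at every `ω`, so the two integrals together see only `A`.
  have hsum : ∫⁻ ω, ENNReal.ofReal (Ψ ((2 : ℝ) • (y ω • A ω))) ∂μ +
      ∫⁻ ω, ENNReal.ofReal (Ψ ((-2 : ℝ) • (y ω • A ω))) ∂μ ≤ J + J := by
    rw [← lintegral_add_left (by fun_prop)]
    refine le_trans (le_of_eq ?_) (add_le_add hplus hminus)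
    rw [← lintegral_add_left (by fun_prop)]
    refine lintegral_congr fun ω => ?_
    rcases hsign ω with h | h
    · rw [h, smul_smul, smul_smul, add_comm]; norm_num
    · rw [h, one_smul]
  calc ∫⁻ ω, ENNReal.ofReal (Ψ (y ω • A ω - v)) ∂μ
      ≤ ∫⁻ ω, ENNReal.ofReal (1 / 2) * (ENNReal.ofReal (Ψ ((2 : ℝ) • (y ω • A ω))) +
        ENNReal.ofReal (Ψ ((-2 : ℝ) • v))) ∂μ := lintegral_mono hpt
    _ = ENNReal.ofReal (1 / 2) * (∫⁻ ω, ENNReal.ofReal (Ψ ((2 : ℝ) • (y ω • A ω))) ∂μ +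
        ENNReal.ofReal (Ψ ((-2 : ℝ) • v))) := by
        rw [lintegral_const_mul' _ _ ENNReal.ofReal_ne_top, lintegral_add_right _ (by fun_prop)]
        simp
    _ ≤ ENNReal.ofReal (1 / 2) * (J + J) := by
        refine mul_le_mul_right ?_ _
        exact (add_le_add_right hjen _).trans hsum
    _ = J := by
        rw [← two_mul, ← mul_assoc, ← ENNReal.ofReal_ofNat 2, ← ENNReal.ofReal_mul (by norm_num)]
        norm_num

end SignedVectors

/-! ### Moments of the coordinate law. -/

section Moments

variable {Ω : Type*} [MeasurableSpace Ω] {P : Measure Ω} {a : Ω → ℝ}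

/-- If the norm vanished, `a` would be zero almost surely, against the unit variance. Positivity is
needed to rescale tails by `κ`. -/
lemma subgaussianNorm_toReal_pos (ha : Measurable a) (hκ : subgaussianNorm a P < ∞)
    (hvar : variance a P = 1) : 0 < (subgaussianNorm a P).toReal := by
  refine lt_of_le_of_ne ENNReal.toReal_nonneg fun h => ?_
  have h1 := eLpNorm_le_of_subgaussianNorm_lt_top hκ le_rfl
  rw [← h, zero_mul, ENNReal.ofReal_zero, nonpos_iff_eq_zero,
    eLpNorm_eq_zero_iff ha.aestronglyMeasurable (by simp)] at h1
  rw [variance_congr h1, variance_zero] at hvar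
  exact zero_ne_one hvar

lemma memLp_id_map {p : ℝ≥0∞} (ha : Measurable a) (h : MemLp a p P) :
    MemLp (fun t : ℝ => t) p (P.map a) :=
  (memLp_map_measure_iff (g := fun t : ℝ => t) (by fun_prop) ha.aemeasurable).2 h

lemma memLp_four_of_subgaussianNorm (ha : Measurable a) (hκ : subgaussianNorm a P < ∞) :
    MemLp a 4 P := by
  have := memLp_of_subgaussianNorm_lt_top ha hκ (p := 4) (by norm_num)
  rwa [ENNReal.ofReal_ofNat] at this

lemma sqrt_integral_pow_four_le (ha : Measurable a) (hκ : subgaussianNorm a P < ∞) :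
    √(∫ t, t ^ 4 ∂(P.map a)) ≤ 4 * (subgaussianNorm a P).toReal ^ 2 := by
  set κ := (subgaussianNorm a P).toReal with hκdef
  have hκ0 : 0 ≤ κ := ENNReal.toReal_nonneg
  rw [integral_map ha.aemeasurable (by fun_prop)]
  have h1 := eLpNorm_le_of_subgaussianNorm_lt_top hκ (p := 4) (by norm_num)
  rw [show √(4 : ℝ) = 2 by rw [show (4 : ℝ) = 2 ^ 2 by norm_num]; simp, ENNReal.ofReal_ofNat,
    (memLp_four_of_subgaussianNorm ha hκ).eLpNorm_eq_integral_rpow_norm (by simp) (by simp),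
    ENNReal.ofReal_le_ofReal_iff (by positivity)] at h1
  have h2 : ∫ ω, ‖a ω‖ ^ (4 : ℝ≥0∞).toReal ∂P = ∫ ω, a ω ^ 4 ∂P := by
    refine integral_congr_ae (Filter.Eventually.of_forall fun ω => ?_)
    simp only [ENNReal.toReal_ofNat]
    rw [Real.norm_eq_abs, show (4 : ℝ) = ((4 : ℕ) : ℝ) by norm_num, Real.rpow_natCast]
    exact Even.pow_abs (by decide) _
  rw [h2] at h1
  have hI : 0 ≤ ∫ ω, a ω ^ 4 ∂P := integral_nonneg fun ω => Even.pow_nonneg (by decide) _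
  have h3 := pow_le_pow_left₀ (by positivity) h1 4
  rw [← Real.rpow_natCast, ← Real.rpow_mul hI] at h3
  simp only [ENNReal.toReal_ofNat] at h3
  norm_num at h3
  rw [Real.sqrt_le_iff]
  exact ⟨by positivity, h3.trans (le_of_eq (by ring))⟩

lemma integral_id_map_eq_zero_of_symm (ha : Measurable a) (hsym : IdentDistrib a (-a) P P) :
    ∫ t, t ∂(P.map a) = 0 := by
  rw [integral_map ha.aemeasurable (by fun_prop)]
  have h := hsym.integral_eq
  simp only [Pi.neg_apply, integral_neg] at h
  linarith

end Moments

/-! ### The mean of a signed measurement is close to a multiple of `x`. -/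

section Bias

variable {Ω : Type*} [MeasurableSpace Ω] {μ : Measure Ω} {m n : ℕ}
  {θ : ℝ → ℝ} {x : EuclideanSpace ℝ (Fin n)}
  {A : Fin m → Ω → EuclideanSpace ℝ (Fin n)} {y : Fin m → Ω → ℝ}

lemma integrable_euclidean {B : Ω → EuclideanSpace ℝ (Fin n)}
    (h : ∀ j, Integrable (fun ω => B ω j) μ) : Integrable B μ := by
  have h1 : B = fun ω => ∑ j, B ω j • EuclideanSpace.basisFun (Fin n) ℝ j := by
    ext1 ω
    simpa using ((EuclideanSpace.basisFun (Fin n) ℝ).sum_repr (B ω)).symm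
  rw [h1]
  exact integrable_finsetSum _ fun j _ => (h j).smul_const _

lemma GeneralizedLinearModel.integrable_smul (h : GeneralizedLinearModel μ θ x A y) {i : Fin m}
    (hi : Integrable (A i) μ) : Integrable (fun ω => y i ω • A i ω) μ :=
  hi.bdd_smul 1 (h.measurable i).aestronglyMeasurable
    (Filter.Eventually.of_forall fun ω => (h.abs_eq_one i ω).le)

/-- The error in coordinate `j` is at most `|x j|` times a common bound, so Cauchy–Schwarz with `‖x‖
= 1` sums the errors without dependence on `n`. -/
lemma GeneralizedLinearModel.abs_inner_integral_sub_le [IsProbabilityMeasure μ]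
    (h : GeneralizedLinearModel μ θ x A y) (hA : ∀ i, Measurable (A i)) (i : Fin m) {ν : Measure ℝ} [IsProbabilityMeasure ν]
    (hind : iIndepFun (fun j ω => A i ω j) μ) (hlaw : ∀ j, μ.map (fun ω => A i ω j) = ν)
    {ε τ : ℝ} (hε : tvDist ν (gaussianReal 0 1) ≤ ε) (h4 : MemLp (fun t : ℝ => t) 4 ν)
    (hmean : ∫ t, t ∂ν = 0) (hθ : ContDiff ℝ 1 θ) (hτ : ∀ t, |deriv θ t| ≤ τ) (hx : ‖x‖ = 1)
    (z : EuclideanSpace ℝ (Fin n)) :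
    |⟪∫ ω, y i ω • A i ω ∂μ, z⟫ - (∫ t, θ t * t ∂(gaussianReal 0 1)) * ⟪x, z⟫| ≤
      5 * τ * √ε * (√(∫ t, t ^ 4 ∂ν) + √(∫ t, t ^ 4 ∂(gaussianReal 0 1)) + 2) * ‖z‖ := by
  set b := 5 * τ * √ε * (√(∫ t, t ^ 4 ∂ν) + √(∫ t, t ^ 4 ∂(gaussianReal 0 1)) + 2) with hb
  have hb0 : 0 ≤ b := by
    have : 0 ≤ τ := (abs_nonneg _).trans (hτ 0)
    positivity
  have hcm : ∀ j, Measurable fun ω => A i ω j := fun j => by have := hA i; fun_prop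
  have hci : ∀ j, Integrable (fun ω => A i ω j) μ := fun j =>
    (memLp_of_map_eq (hcm j) (hlaw j) h4).integrable (by norm_num)
  have hint := h.integrable_smul (integrable_euclidean hci)
  have hcoord : ∀ j, (∫ ω, y i ω • A i ω ∂μ) j = ∫ ω, θ (∑ k, x k * A i ω k) * A i ω j ∂μ := by
    intro j
    have h1 := ContinuousLinearMap.integral_comp_comm (EuclideanSpace.proj (𝕜 := ℝ) j) hint
    have h2 := h.integral_mul_eq hA i (g := fun v => v j) (by fun_prop) (hci j)
    have h3 : ∀ ω, ⟪A i ω, x⟫ = ∑ k, x k * A i ω k := fun ω => by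
      simp [PiLp.inner_apply]
    simp only [h3] at h2
    rw [← h2]
    exact h1.symm
  have hxs : ∑ k, x k ^ 2 = 1 := by
    have := EuclideanSpace.real_norm_sq_eq x
    rw [← this, hx, one_pow]
  have hbound := fun j => abs_integral_comp_sum_mul_sub_gaussian_le (X := fun j ω => A i ω j)
    hcm hind hlaw hε h4 hmean (fun t => (hθ.differentiable one_ne_zero t).hasDerivAt)
    (hθ.continuous_deriv le_rfl) hτ x hxs j
  simp only [← hb] at hbound
  set lam := ∫ t, θ t * t ∂(gaussianReal 0 1) with hlam
  have hexp : ⟪∫ ω, y i ω • A i ω ∂μ, z⟫ - lam * ⟪x, z⟫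
      = ∑ j, (∫ ω, θ (∑ k, x k * A i ω k) * A i ω j ∂μ - x j * lam) * z j := by
    simp only [PiLp.inner_apply, hcoord, RCLike.inner_apply, conj_trivial]
    rw [Finset.mul_sum, ← Finset.sum_sub_distrib]
    exact Finset.sum_congr rfl fun j _ => by ring
  rw [hexp]
  calc _ ≤ ∑ j, |x j| * b * |z j| := by
        refine (Finset.abs_sum_le_sum_abs _ _).trans (Finset.sum_le_sum fun j _ => ?_)
        rw [abs_mul]
        exact mul_le_mul_of_nonneg_right (hbound j) (abs_nonneg _)
    _ = b * ∑ j, |x j| * |z j| := by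
        rw [Finset.mul_sum]
        exact Finset.sum_congr rfl fun j _ => by ring
    _ ≤ b * (‖x‖ * ‖z‖) := by
        refine mul_le_mul_of_nonneg_left ?_ hb0
        refine (Real.sum_mul_le_sqrt_mul_sqrt _ _ _).trans (le_of_eq ?_)
        simp only [sq_abs, EuclideanSpace.norm_eq, Real.norm_eq_abs]
    _ = b * ‖z‖ := by rw [hx, one_mul]

end Bias

/-! ### Tail of the supremum of the fluctuation over `K - K`. -/

section Concentration

variable {n : ℕ}

lemma stdGaussian_map_smul_neg (c : ℝ) :
    ((stdGaussian (EuclideanSpace ℝ (Fin n))).map fun v => c • v).map (fun v => -v) =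
      (stdGaussian (EuclideanSpace ℝ (Fin n))).map fun v => c • v := by
  have h := stdGaussian_map (LinearIsometryEquiv.neg ℝ (E := EuclideanSpace ℝ (Fin n)))
  conv_rhs => rw [← h]
  rw [Measure.map_map (by fun_prop) (by fun_prop),
    Measure.map_map (by fun_prop) (LinearIsometryEquiv.continuous _).measurable]
  congr 1
  ext1 v
  simp

/-- A random vector dominated by a multiple of the standard Gaussian vector inherits its tail
bound for support functions. -/
lemma measure_le_supportFunction_le {Ω : Type*} [MeasurableSpace Ω] {μ : Measure Ω}
    {D : Ω → EuclideanSpace ℝ (Fin n)} (hD : Measurable D) {L : ℝ} (hL : 0 < L)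
    (hdom : ConvexDominated (μ.map D)
      ((stdGaussian (EuclideanSpace ℝ (Fin n))).map fun v => L • v))
    {T : Set (EuclideanSpace ℝ (Fin n))} (hT : T.Nonempty) (hR : ∀ z ∈ T, ‖z‖ ≤ 2) {β : ℝ}
    (hβ : 0 < β) :
    μ {ω | L * (∫ u, supportFunction T u ∂(stdGaussian (EuclideanSpace ℝ (Fin n))) + 5 * β) ≤
      supportFunction T (D ω)} ≤ ENNReal.ofReal (Real.exp (-β ^ 2)) := by
  set w := ∫ u, supportFunction T u ∂(stdGaussian (EuclideanSpace ℝ (Fin n))) with hw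
  have hFc := continuous_supportFunction hT hR
  have hFconv := convexOn_supportFunction hT hR
  set S := β / 2 with hS
  have hS0 : 0 ≤ S := by positivity
  set Ψ : EuclideanSpace ℝ (Fin n) → ℝ := fun d => Real.exp (S / L * supportFunction T d) with hΨ
  have hΨconv : ConvexOn ℝ Set.univ Ψ := by
    refine (convexOn_exp.subset (Set.subset_univ _) ?_).comp
      (hFconv.smul (by positivity : 0 ≤ S / L)) (Real.exp_monotone.monotoneOn _)
    exact ((convex_univ.isPreconnected).image _ (by fun_prop)).ordConnected.convex
  have hΨm : Measurable fun d => ENNReal.ofReal (Ψ d) := by fun_prop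
  have h1 := hdom Ψ hΨconv (by fun_prop) fun d => (Real.exp_pos _).le
  rw [lintegral_map hΨm hD, lintegral_map hΨm (by fun_prop)] at h1
  have h2 : ∀ v, Ψ (L • v) = Real.exp (S * supportFunction T v) := fun v => by
    simp only [hΨ]
    rw [supportFunction_smul hL.le]
    congr 1
    field_simp
  simp only [h2] at h1
  have h3 := h1.trans (lintegral_exp_supportFunction_stdGaussian_le hT hR hS0)
  rw [← hw] at h3
  have h4 := mul_meas_ge_le_lintegral (μ := μ) (hΨm.comp hD)
    (ENNReal.ofReal (Real.exp (S * (w + 5 * β))))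
  have hset : {ω | L * (w + 5 * β) ≤ supportFunction T (D ω)} ⊆
      {ω | ENNReal.ofReal (Real.exp (S * (w + 5 * β))) ≤
        ((fun d => ENNReal.ofReal (Ψ d)) ∘ D) ω} := fun ω hω => by
    refine ENNReal.ofReal_le_ofReal (Real.exp_le_exp.2 ?_)
    have h5 := mul_le_mul_of_nonneg_left (show L * (w + 5 * β) ≤ supportFunction T (D ω) from hω)
      (by positivity : 0 ≤ S / L)
    refine le_trans (le_of_eq ?_) h5
    field_simp
  have h6 := (mul_le_mul_right (measure_mono (μ := μ) hset)
    (ENNReal.ofReal (Real.exp (S * (w + 5 * β))))).trans (h4.trans h3)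
  have h7 := mul_le_mul_right h6 (ENNReal.ofReal (Real.exp (-(S * (w + 5 * β)))))
  rw [← mul_assoc, ← ENNReal.ofReal_mul (Real.exp_pos _).le, ← Real.exp_add, neg_add_cancel,
    Real.exp_zero, ENNReal.ofReal_one, one_mul, ← ENNReal.ofReal_mul (Real.exp_pos _).le,
    ← Real.exp_add] at h7
  refine h7.trans (ENNReal.ofReal_le_ofReal (Real.exp_le_exp.2 ?_))
  -- With `R = 2` and `S = β / 2` the exponent is `-5β²/2 + π²β²/8`, and `π² ≤ 12` makes it at most
  -- `-β²`; this explains the `5 * β` in the threshold.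
  have hpi : Real.pi ^ 2 ≤ 12 := by
    have := Real.pi_lt_d2
    have := Real.pi_pos
    nlinarith
  rw [hS]
  nlinarith [sq_nonneg β, mul_le_mul_of_nonneg_right hpi (sq_nonneg β)]

variable {Ω : Type*} [MeasurableSpace Ω] {μ : Measure Ω} [IsProbabilityMeasure μ] {m : ℕ}
  {θ : ℝ → ℝ} {x : EuclideanSpace ℝ (Fin n)}
  {A : Fin m → Ω → EuclideanSpace ℝ (Fin n)} {y : Fin m → Ω → ℝ}

/-- The factor `2` is the price of signing and recentring; `√m` comes from adding `m` independent
dominated terms. -/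
lemma GeneralizedLinearModel.convexDominated_sum (h : GeneralizedLinearModel μ θ x A y)
    (hA : ∀ i, Measurable (A i)) (hind : iIndepFun A μ) (hθ : Continuous θ)
    (hint : ∀ i, Integrable (A i) μ) {c : ℝ} (hc : 0 ≤ c)
    (hdom : ∀ i, ConvexDominated (μ.map (A i))
      ((stdGaussian (EuclideanSpace ℝ (Fin n))).map fun v => c • v)) :
    ConvexDominated (μ.map fun ω => ∑ i, (y i ω • A i ω - ∫ ω', y i ω' • A i ω' ∂μ))
      ((stdGaussian (EuclideanSpace ℝ (Fin n))).map fun v => (2 * c * √m) • v) := by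
  have hm : ∀ i, Measurable fun ω => y i ω • A i ω := fun i => (h.measurable i).smul (hA i)
  have := convexDominated_stdGaussian_sum
    (Z := fun i ω => y i ω • A i ω - ∫ ω', y i ω' • A i ω' ∂μ)
    (fun i => (hm i).sub_const _)
    ((h.iIndepFun_smul hA hind hθ).comp (fun i u => u - ∫ ω', y i ω' • A i ω' ∂μ)
      fun i => by fun_prop) (c := 2 * c) (by positivity) fun i => by
        have h1 := convexDominated_sign_smul_sub_integral (hA i) (h.measurable i)
          (h.sign_valued i) (h.integrable_smul (hint i)) (stdGaussian_map_smul_neg c) (hdom i)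
        rw [Measure.map_map (by fun_prop) (by fun_prop)] at h1
        convert h1 using 3
        simp [mul_smul]
  simpa using this

end Concentration

/-! ### The deterministic error inequality, the constants and the conclusion. -/

lemma norm_sub_sq_le_of_isSolution {m n : ℕ} {K : Set (EuclideanSpace ℝ (Fin n))}
    (hK : K ⊆ Metric.closedBall 0 1) {x : EuclideanSpace ℝ (Fin n)} (hxK : x ∈ K) (hx : ‖x‖ = 1)
    {a v : Fin m → EuclideanSpace ℝ (Fin n)} {y : Fin m → ℝ} {lam b r : ℝ} (hm : 0 < m)
    (hlam : 0 < lam) (hb : 0 ≤ b) (hv : ∀ i z, |⟪v i, z⟫ - lam * ⟪x, z⟫| ≤ b * ‖z‖)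
    (hr : supportFunction (K - K) (∑ i, (y i • a i - v i)) ≤ r) {z : EuclideanSpace ℝ (Fin n)}
    (hz : IsSolution K a y z) : ‖x - z‖ ^ 2 ≤ (4 * b + 2 * r / m) / lam := by
  obtain ⟨hzK, hmax⟩ := hz
  have hnorm : ∀ u ∈ K, ‖u‖ ≤ 1 := fun u hu => by simpa using hK hu
  have hR : ∀ u ∈ K - K, ‖u‖ ≤ 2 := by
    rintro _ ⟨u, hu, u', hu', rfl⟩
    have := norm_sub_le u u'
    have := hnorm u hu
    have := hnorm u' hu'
    linarith
  have hd : z - x ∈ K - K := Set.sub_mem_sub hzK hxK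
  have h1 := (inner_le_supportFunction hR (∑ i, (y i • a i - v i)) hd).trans hr
  have h2 : ∑ i, y i * ⟪a i, x⟫ ≤ ∑ i, y i * ⟪a i, z⟫ := hmax hxK
  have h3 : ⟪∑ i, (y i • a i - v i), z - x⟫ =
      ∑ i, y i * ⟪a i, z⟫ - ∑ i, y i * ⟪a i, x⟫ - ∑ i, ⟪v i, z - x⟫ := by
    rw [sum_inner, ← Finset.sum_sub_distrib, ← Finset.sum_sub_distrib]
    refine Finset.sum_congr rfl fun i _ => ?_
    rw [inner_sub_left, inner_smul_left, inner_sub_right (a i)]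
    simp only [conj_trivial]
    ring
  -- The bias enters as `b * ‖z - x‖`, at most `2 * b` because both points lie in the unit ball.
  have h4 : ∑ i, ⟪v i, z - x⟫ ≤ m * (lam * ⟪x, z - x⟫ + 2 * b) := by
    calc ∑ i, ⟪v i, z - x⟫ ≤ ∑ _i : Fin m, (lam * ⟪x, z - x⟫ + 2 * b) := by
          refine Finset.sum_le_sum fun i _ => ?_
          have h5 := (le_abs_self _).trans (hv i (z - x))
          have h6 := mul_le_mul_of_nonneg_left (hR _ hd) hb
          linarith
      _ = _ := by rw [Finset.sum_const, Finset.card_univ, Fintype.card_fin, nsmul_eq_mul]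
  -- Curvature of the sphere: expanding `‖x - z‖ ^ 2` with `‖z‖ ≤ 1 = ‖x‖` turns linear decrease
  -- into a squared distance.
  have h7 : ⟪x, z - x⟫ ≤ -‖x - z‖ ^ 2 / 2 := by
    have h8 := norm_sub_sq_real x z
    have h9 : ‖z‖ ^ 2 ≤ 1 := pow_le_one₀ (norm_nonneg _) (hnorm z hzK)
    rw [inner_sub_right, real_inner_self_eq_norm_sq]
    rw [hx] at h8 ⊢
    linarith
  have hm0 : (0 : ℝ) < m := by exact_mod_cast hm
  have h10 : m * (lam * ‖x - z‖ ^ 2 / 2 - 2 * b) ≤ r := by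
    have h11 := mul_le_mul_of_nonneg_left h7 hlam.le
    have h12 : m * (lam * ⟪x, z - x⟫ + 2 * b) ≤ m * (lam * (-‖x - z‖ ^ 2 / 2) + 2 * b) := by gcongr
    nlinarith
  have h13 : lam * ‖x - z‖ ^ 2 / 2 - 2 * b ≤ r / m := by
    rw [le_div_iff₀ hm0, mul_comm]; exact h10
  rw [le_div_iff₀ hlam, mul_div_assoc]
  linarith

/-- The bias gives `4 * 5 * (G + 6)`, since `κ ^ 2 ≤ κ ^ 3 + 1` yields `4 * κ ^ 2 + G + 2 ≤ (G + 6)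
* (κ ^ 3 + 1)`. The fluctuation gives `80 * e * 5 ≤ 1200`. -/
lemma error_bound_le {G κ τ₁ τ₂ ε lam w β M s₄ : ℝ} (hG : 0 ≤ G) (hκ : 0 ≤ κ) (hτ₁ : 0 ≤ τ₁)
    (hτ₂ : 0 ≤ τ₂) (hlam : 0 < lam) (hw : 0 ≤ w) (hβ : 0 ≤ β) (hM : 0 < M)
    (hs : s₄ ≤ 4 * κ ^ 2) :
    (4 * (5 * τ₁ * √ε * (s₄ + G + 2)) +
        2 * (2 * (20 * (Real.exp 1 * κ)) * √M * (w + 5 * β)) / M) / lam ≤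
      (1200 + 20 * (G + 6)) * (((κ ^ 3 + 1) * (τ₁ + τ₂) * √ε) / lam +
        κ * (w + β) / (lam * √M)) := by
  have hsM : 0 < √M := Real.sqrt_pos.2 hM
  have h1 : 5 * τ₁ * √ε * (s₄ + G + 2) ≤
      5 * (τ₁ + τ₂) * √ε * ((G + 6) * (κ ^ 3 + 1)) := by
    have h2 : s₄ + G + 2 ≤ (G + 6) * (κ ^ 3 + 1) := by
      have : κ ^ 2 ≤ κ ^ 3 + 1 := by nlinarith [sq_nonneg (κ - 1), mul_nonneg hκ (sq_nonneg (κ - 1))]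
      have : 0 ≤ κ ^ 3 := by positivity
      nlinarith [mul_nonneg hG this]
    have h3 : 5 * τ₁ * √ε * (s₄ + G + 2) ≤ 5 * τ₁ * √ε * ((G + 6) * (κ ^ 3 + 1)) :=
      mul_le_mul_of_nonneg_left h2 (by positivity)
    refine h3.trans ?_
    gcongr
    linarith
  have h4 : 2 * (2 * (20 * (Real.exp 1 * κ)) * √M * (w + 5 * β)) / M ≤
      1200 * (κ * (w + β) / √M) := by
    have h5 : 2 * (2 * (20 * (Real.exp 1 * κ)) * √M * (w + 5 * β)) / M =
        80 * Real.exp 1 * (κ * (w + 5 * β) / √M) := by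
      calc _ = 80 * Real.exp 1 * (κ * (w + 5 * β)) * (√M / M) := by ring
        _ = _ := by rw [Real.sqrt_div_self']; ring
    have h6 : Real.exp 1 ≤ 3 := by have := Real.exp_one_lt_d9; linarith
    rw [h5]
    calc 80 * Real.exp 1 * (κ * (w + 5 * β) / √M) ≤ 80 * 3 * (κ * (5 * (w + β)) / √M) := by
          gcongr
          linarith
      _ = 1200 * (κ * (w + β) / √M) := by ring
  have h7 : (1200 + 20 * (G + 6)) * (((κ ^ 3 + 1) * (τ₁ + τ₂) * √ε) / lam +
        κ * (w + β) / (lam * √M)) =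
      ((1200 + 20 * (G + 6)) * ((κ ^ 3 + 1) * (τ₁ + τ₂) * √ε) +
        (1200 + 20 * (G + 6)) * (κ * (w + β) / √M)) / lam := by
    field_simp
  rw [h7]
  refine div_le_div_of_nonneg_right ?_ hlam.le
  have h8 : 0 ≤ (κ ^ 3 + 1) * (τ₁ + τ₂) * √ε := by positivity
  have h9 : 0 ≤ κ * (w + β) / √M := by positivity
  have h10 : 0 ≤ 20 * (G + 6) * (κ * (w + β) / √M) := by positivity
  nlinarith

theorem mainTheorem5 :
    ∃ C : ℝ, 0 < C ∧
      ∀ (Ω₀ : Type*) [MeasurableSpace Ω₀] (P : Measure Ω₀) [IsProbabilityMeasure P]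
        (a : Ω₀ → ℝ), Measurable a →
        IdentDistrib a (-a) P P →
        variance a P = 1 →
        subgaussianNorm a P < ∞ →
      ∀ ε : ℝ, tvDist (P.map a) (gaussianReal 0 1) ≤ ε →
      ∀ (m n : ℕ), 0 < m →
      ∀ (Ω : Type*) [MeasurableSpace Ω] (μ : Measure Ω) [IsProbabilityMeasure μ]
        (A : Fin m → Ω → EuclideanSpace ℝ (Fin n)), (∀ i, Measurable (A i)) →
        iIndepFun A μ →
        (∀ i, iIndepFun (fun (j : Fin n) ω => A i ω j) μ) →
        (∀ i j, IdentDistrib (fun ω => A i ω j) a μ P) →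
      ∀ (K : Set (EuclideanSpace ℝ (Fin n))), K ⊆ Metric.closedBall 0 1 →
      ∀ x ∈ K, ‖x‖ = 1 →
      ∀ (θ : ℝ → ℝ) (τ₁ τ₂ lam : ℝ), (∀ t, θ t ∈ Set.Icc (-1) 1) →
        ContDiff ℝ 2 θ →
        (∀ t, |deriv θ t| ≤ τ₁) →
        (∀ t, |iteratedDeriv 2 θ t| ≤ τ₂) →
        lam = ∫ t, θ t * t ∂(gaussianReal 0 1) →
        0 < lam →
      ∀ y : Fin m → Ω → ℝ, GeneralizedLinearModel μ θ x A y →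
      ∀ β : ℝ, 0 < β →
        ∃ E : Set Ω, MeasurableSet E ∧ 1 - 4 * Real.exp (-β ^ 2) ≤ μ.real E ∧
          ∀ ω ∈ E, ∀ xhat : EuclideanSpace ℝ (Fin n),
            IsSolution K (fun i => A i ω) (fun i => y i ω) xhat →
            ‖x - xhat‖ ^ 2 ≤
              C * ((((subgaussianNorm a P).toReal ^ 3 + 1) * (τ₁ + τ₂) * √ε) / lam +
                (subgaussianNorm a P).toReal * (gaussianMeanWidth K + β) / (lam * √m)) := by
  -- An absolute number, so it may enter `C` without being evaluated.
  set G := √(∫ t, t ^ 4 ∂(gaussianReal 0 1)) with hG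
  have hG0 : 0 ≤ G := Real.sqrt_nonneg _
  refine ⟨1200 + 20 * (G + 6), by positivity, ?_⟩
  intro Ω₀ _ P _ a ha hsym hvar hκ ε hε m n hm Ω _ μ _ A hA hind hindc hid K hK x hxK hx θ τ₁ τ₂
    lam _ hθ hτ₁ hτ₂ hlam hlam0 y hy β hβ
  set κ := (subgaussianNorm a P).toReal with hκdef
  have hκ0 : 0 < κ := subgaussianNorm_toReal_pos ha hκ hvar
  have : IsProbabilityMeasure (P.map a) := Measure.isProbabilityMeasure_map ha.aemeasurable
  have h4 := memLp_id_map ha (memLp_four_of_subgaussianNorm ha hκ)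
  have hmean := integral_id_map_eq_zero_of_symm ha hsym
  have hlaw : ∀ i j, μ.map (fun ω => A i ω j) = P.map a := fun i j => (hid i j).map_eq
  have hint : ∀ i, Integrable (A i) μ := fun i => integrable_euclidean fun j =>
    (memLp_of_map_eq (by have := hA i; fun_prop) (hlaw i j) h4).integrable (by norm_num)
  have hdomA : ∀ i, ConvexDominated (μ.map (A i))
      ((stdGaussian (EuclideanSpace ℝ (Fin n))).map
        fun v => (20 * (Real.exp 1 * κ)) • v) := fun i =>
    convexDominated_stdGaussian_of_coordinates (hA i) (hindc i) fun j => by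
      rw [hlaw i j]
      exact convexDominated_gaussian_of_subgaussianNorm ha hsym hκ hκ0
  have hc0 : 0 < 20 * (Real.exp 1 * κ) := by positivity
  have hm0 : (0 : ℝ) < m := by exact_mod_cast hm
  set D : Ω → EuclideanSpace ℝ (Fin n) :=
    fun ω => ∑ i, (y i ω • A i ω - ∫ ω', y i ω' • A i ω' ∂μ) with hD
  have hDm : Measurable D := by
    have := hy.measurable
    fun_prop
  have hdomD : ConvexDominated (μ.map D) _ :=
    hy.convexDominated_sum hA hind hθ.continuous hint hc0.le hdomA
  have hT : (K - K).Nonempty := ⟨x - x, Set.sub_mem_sub hxK hxK⟩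
  have hR : ∀ z ∈ K - K, ‖z‖ ≤ 2 := by
    rintro _ ⟨u, hu, u', hu', rfl⟩
    have h1 := norm_sub_le u u'
    have h2 : ‖u‖ ≤ 1 := by simpa using hK hu
    have h3 : ‖u'‖ ≤ 1 := by simpa using hK hu'
    linarith
  have hw : gaussianMeanWidth K =
      ∫ u, supportFunction (K - K) u ∂(stdGaussian (EuclideanSpace ℝ (Fin n))) := rfl
  have hw0 : 0 ≤ gaussianMeanWidth K := by
    rw [hw]
    refine integral_nonneg fun u => ?_
    have := inner_le_supportFunction hR u (Set.sub_mem_sub hxK hxK)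
    simpa using this
  have htail := measure_le_supportFunction_le hDm (by positivity) hdomD hT hR hβ
  rw [← hw] at htail
  set r := 2 * (20 * (Real.exp 1 * κ)) * √m * (gaussianMeanWidth K + 5 * β) with hr
  have hFD : Measurable fun ω => supportFunction (K - K) (D ω) :=
    (continuous_supportFunction hT hR).measurable.comp hDm
  have hmeas : MeasurableSet {ω | r ≤ supportFunction (K - K) (D ω)} :=
    measurableSet_le measurable_const hFD
  -- A single exceptional event, of probability at most `exp (-β ^ 2)`, serves all solutions at
  -- once; the factor `4` in the statement is slack.
  refine ⟨{ω | r ≤ supportFunction (K - K) (D ω)}ᶜ, hmeas.compl, ?_, fun ω hω xhat hxhat => ?_⟩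
  · have h1 : μ.real {ω | r ≤ supportFunction (K - K) (D ω)} ≤ Real.exp (-β ^ 2) :=
      ENNReal.toReal_le_of_le_ofReal (Real.exp_pos _).le htail
    rw [probReal_compl_eq_one_sub hmeas]
    have := Real.exp_pos (-β ^ 2)
    linarith
  · have hle : supportFunction (K - K) (D ω) ≤ r := (not_le.1 (Set.notMem_ofPred_iff.1 hω)).le
    have hτ₁0 : 0 ≤ τ₁ := (abs_nonneg _).trans (hτ₁ 0)
    refine (norm_sub_sq_le_of_isSolution hK hxK hx hm hlam0 (by positivity)
      (v := fun i => ∫ ω', y i ω' • A i ω' ∂μ) (fun i z => ?_) hle hxhat).trans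
      (error_bound_le hG0 hκ0.le hτ₁0 ((abs_nonneg _).trans (hτ₂ 0)) hlam0 hw0 hβ.le hm0
        (sqrt_integral_pow_four_le ha hκ))
    rw [hlam]
    exact hy.abs_inner_integral_sub_le hA i (hindc i) (hlaw i) hε h4 hmean
      (hθ.of_le (by norm_num)) hτ₁ hx z
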